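/- Let $G$ be a graph on $n$ vertices, let $w\in\mathbb{R}^n_{\ge 0}$, and let $S_1,\dots,S_n$ be Pauli strings of length $\ell$ (tensor products of $\ell$ matrices from $\{\mathbb 1,X,Y,Z\}$, acting on $\mathcal H=\mathbb{C}^d$ with $d=2^\ell$) whose frustration graph is $G$, i.e. $S_i$ and $S_j$ anti-commute if $i,j$ are adjacent in $G$ and commute otherwise. Let $$\beta(G,w)=\sup_\rho \sum_{i=1}^n w_i\,(\operatorname{tr}[\rho S_i])^2,$$ the supremum being over all density matrices $\rho$ on $\mathcal H$. Put $H_S=\sum_{i=1}^n w_i\, S_i\otimes S_i$ and $\operatorname{Sym}^{N}(\mathcal H)=\operatorname{span}\{\psi^{\otimes N}:\psi\in\mathcal H\}\subset\mathcal H^{\otimes N}$, and for integers $m\ge 0$ let $$c^{(m)}=\max\big\{\operatorname{tr}[\sigma(H_S\otimes\mathbb 1^{\otimes m})]\;:\;\sigma\ge 0,\ \operatorname{tr}\sigma=1,\ \operatorname{range}\sigma\subseteq\operatorname{Sym}^{m+2}(\mathcal H)\big\}.$$ 1. The maximum $c^{(m)}$ is attained, $c^{(0)}\ge c^{(1)}\ge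 c^{(2)}\ge\cdots$, $c^{(m)}\ge\beta(G,w)$ for all $m$, and $\lim_{m\to\infty}c^{(m)}=\beta(G,w)$. Moreover there is an absolute constant $C>0$ (independent of $n,\ell,G,S,w,m$) such that, whenever $\sum_i w_i\le K n$ for a real number $K$, one has for all $m\ge 1$ $$0\le c^{(m)}-\beta(G,w)\le C\,K\,\frac{nd}{m}.$$ 2. Each level can be initialized in time polynomial in $m$. For a multiset $s$ of size $m+2$ of computational basis labels of $\mathcal H$, let $v_s=\sum_x e_x\in\mathcal H^{\otimes(m+2)}$, where $x$ runs over the sequences of labels whose multiset of entries is $s$. The vectors $v_s$ form a basis of $\operatorname{Sym}^{m+2}(\mathcal H)$, and with $A_{st}=\langle v_s,(H_S\otimes\mathbb 1^{\otimes m})v_t\rangle$ and $\Gamma_{st}=\langle v_s,v_t\rangle$ one has $$c^{(m)}=\max\{\operatorname{tr}[XA]: X\ge 0,\ \operatorname{tr}[X\Gamma]=1\}.$$ For every choice of $S_1,\dots,S_n$ there are a program and a polynomial $p$ such that, on input $m$ and $w$, the program lists all multisets $s$ of size $m+2$ (by their multiplicities), and all entries of the matrices $A$ and $\Gamma$, in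 at most $p(m)$ steps. Here programs run on a random access machine in which operations on natural numbers are charged by their bit length, and real numbers can be stored, read and combined by field operations at unit cost. -/

import Mathlib

open scoped Kronecker ComplexOrder

namespace BoseHierarchy

noncomputable section

/-! ## Pauli strings, frustration graphs, the beta number -/

/-- The labels of the four single-qubit Pauli matrices. -/
inductive Pauli where
  | I : Pauli
  | X : Pauli
  | Y : Pauli
  | Z : Pauli

/-- The `2 × 2` matrix of a Pauli label. -/
def Pauli.mat : Pauli → Matrix (Fin 2) (Fin 2) ℂ
  | Pauli.I => !![1, 0; 0, 1]
  | Pauli.X => !![0, 1; 1, 0]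
  | Pauli.Y => !![0, -Complex.I; Complex.I, 0]
  | Pauli.Z => !![1, 0; 0, -1]

/-- The computational basis of `ℓ` qubits; it labels a basis of the space `ℂ ^ d`, `d = 2 ^ ℓ`. -/
abbrev Bits (ℓ : ℕ) : Type := Fin ℓ → Fin 2

/-- A Pauli string of length `ℓ`. -/
abbrev PauliString (ℓ : ℕ) : Type := Fin ℓ → Pauli

/-- The matrix of a Pauli string: the tensor product of its `ℓ` factors. -/
def PauliString.mat {ℓ : ℕ} (s : PauliString ℓ) : Matrix (Bits ℓ) (Bits ℓ) ℂ :=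
  fun x y => ∏ k, (s k).mat (x k) (y k)

/-- `G` is the frustration graph of the strings `S`: two vertices are adjacent if and only if
their strings anti-commute (any other two strings commute). -/
def IsFrustrationGraph {n ℓ : ℕ} (G : SimpleGraph (Fin n)) (S : Fin n → PauliString ℓ) : Prop :=
  ∀ i j, G.Adj i j ↔ (S i).mat * (S j).mat = -((S j).mat * (S i).mat)

/-- Density matrices. -/
def IsState {ι : Type} [Fintype ι] (ρ : Matrix ι ι ℂ) : Prop :=
  ρ.PosSemidef ∧ ρ.trace = 1

/-- The expectation value `tr (ρ A)` of a Hermitian `A` in the state `ρ`. -/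
def expect {ι : Type} [Fintype ι] (ρ A : Matrix ι ι ℂ) : ℝ :=
  (ρ * A).trace.re

/-- The weighted beta number: the supremum of `∑ i, w i * ⟨S i⟩_ρ ^ 2` over all states `ρ`. -/
def betaNumber {n ℓ : ℕ} (S : Fin n → PauliString ℓ) (w : Fin n → ℝ) : ℝ :=
  sSup {r : ℝ | ∃ ρ : Matrix (Bits ℓ) (Bits ℓ) ℂ, IsState ρ ∧
    r = ∑ i, w i * expect ρ (S i).mat ^ 2}

/-! ## The Bose-symmetric extension programs -/

/-- `Sym^N` of `ℂ ^ ι`: the span of the vectors `ψ ⊗ ⋯ ⊗ ψ` (`N` factors) in the `N`-fold tensor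
power, whose vectors are written as functions on `Fin N → ι`. -/
def symSubspace (ι : Type) (N : ℕ) : Submodule ℂ ((Fin N → ι) → ℂ) :=
  Submodule.span ℂ (Set.range fun (ψ : ι → ℂ) (x : Fin N → ι) => ∏ k, ψ (x k))

/-- `H_S = ∑ i, w i • S i ⊗ S i`. -/
def pairHamiltonian {n ℓ : ℕ} (S : Fin n → PauliString ℓ) (w : Fin n → ℝ) :
    Matrix (Bits ℓ × Bits ℓ) (Bits ℓ × Bits ℓ) ℂ :=
  ∑ i, (w i : ℂ) • ((S i).mat ⊗ₖ (S i).mat)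

/-- `H ⊗ 1 ⊗ ⋯ ⊗ 1`: the operator `H` on the first two of `m + 2` tensor factors. -/
def extendOp {ι : Type} [DecidableEq ι] (m : ℕ) (H : Matrix (ι × ι) (ι × ι) ℂ) :
    Matrix (Fin (m + 2) → ι) (Fin (m + 2) → ι) ℂ :=
  fun x y => H (x 0, x 1) (y 0, y 1) *
    if ∀ k : Fin m, x k.succ.succ = y k.succ.succ then 1 else 0

/-- The values of the objective at the feasible points of the `m`-th program: states on `m + 2`
copies that live on the symmetric subspace (their range lies in it). -/
def extensionValues {n ℓ : ℕ} (S : Fin n → PauliString ℓ) (w : Fin n → ℝ) (m : ℕ) : Set ℝ :=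
  {r : ℝ | ∃ σ : Matrix (Fin (m + 2) → Bits ℓ) (Fin (m + 2) → Bits ℓ) ℂ,
    IsState σ ∧ (∀ v, σ.mulVec v ∈ symSubspace (Bits ℓ) (m + 2)) ∧
    r = expect σ (extendOp m (pairHamiltonian S w))}

/-- The optimal value `c^(m)` of the `m`-th program. -/
def extensionBound {n ℓ : ℕ} (S : Fin n → PauliString ℓ) (w : Fin n → ℝ) (m : ℕ) : ℝ :=
  sSup (extensionValues S w m)

/-! ## The programs in a basis of the symmetric subspace

The basis vectors are labelled by the multisets of size `N` on `ι` (occupation numbers). -/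

/-- The multiset of the entries of `x`. -/
def occupation {ι : Type} {N : ℕ} (x : Fin N → ι) : Sym ι N :=
  ⟨Finset.univ.val.map x, by simp⟩

/-- The vector `∑ e_x`, over all `x` with occupation `s`. -/
def dickeVector {ι : Type} [DecidableEq ι] {N : ℕ} (s : Sym ι N) : (Fin N → ι) → ℂ :=
  fun x => if occupation x = s then 1 else 0

/-- The Gram matrix of the basis. -/
def gramMatrix (ℓ m : ℕ) : Matrix (Sym (Bits ℓ) (m + 2)) (Sym (Bits ℓ) (m + 2)) ℂ :=
  fun s t => star (dickeVector s) ⬝ᵥ dickeVector t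

/-- The matrix of the sesquilinear form of `H_S ⊗ 1` in the basis. -/
def reducedMatrix {n ℓ : ℕ} (S : Fin n → PauliString ℓ) (w : Fin n → ℝ) (m : ℕ) :
    Matrix (Sym (Bits ℓ) (m + 2)) (Sym (Bits ℓ) (m + 2)) ℂ :=
  fun s t => star (dickeVector s) ⬝ᵥ
    (extendOp m (pairHamiltonian S w)).mulVec (dickeVector t)

/-- The values of the objective of the reduced program: maximize `tr (X A)` over `X ≥ 0` with
`tr (X Γ) = 1`, where `A` is the reduced matrix and `Γ` the Gram matrix. -/
def reducedValues {n ℓ : ℕ} (S : Fin n → PauliString ℓ) (w : Fin n → ℝ) (m : ℕ) : Set ℝ :=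
  {r : ℝ | ∃ X : Matrix (Sym (Bits ℓ) (m + 2)) (Sym (Bits ℓ) (m + 2)) ℂ,
    X.PosSemidef ∧ (X * gramMatrix ℓ m).trace = 1 ∧ r = (X * reducedMatrix S w m).trace.re}

/-! ## A machine model with a step count

Structured programs on a random access machine. Natural numbers are charged by their bit length
(logarithmic cost); real numbers can only be stored, read and combined by field operations, each
at unit cost. Programs contain no real constants and cannot convert reals to natural numbers. -/

/-- A memory state: natural-number registers, natural-number arrays, real arrays. -/
structure Store where
  reg : ℕ → ℕ
  arr : ℕ → ℕ → ℕ
  rarr : ℕ → ℕ → ℝ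

/-- Write `v` into register `i`. -/
def Store.setReg (M : Store) (i v : ℕ) : Store :=
  { M with reg := Function.update M.reg i v }

/-- Write `v` into array `a` at index `k`. -/
def Store.setArr (M : Store) (a k v : ℕ) : Store :=
  { M with arr := Function.update M.arr a (Function.update (M.arr a) k v) }

/-- Write `v` into real array `a` at index `k`. -/
def Store.setRarr (M : Store) (a k : ℕ) (v : ℝ) : Store :=
  { M with rarr := Function.update M.rarr a (Function.update (M.rarr a) k v) }

/-- Natural-number expressions; `arr a e` is the entry of array `a` at the index `e`. -/
inductive NatExpr where
  | const : ℕ → NatExpr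
  | reg : ℕ → NatExpr
  | arr : ℕ → NatExpr → NatExpr
  | add : NatExpr → NatExpr → NatExpr
  | sub : NatExpr → NatExpr → NatExpr
  | mul : NatExpr → NatExpr → NatExpr
  | div : NatExpr → NatExpr → NatExpr
  | lt : NatExpr → NatExpr → NatExpr
  | eq : NatExpr → NatExpr → NatExpr

/-- The value of an expression; a comparison has the value `1` if it holds, and else `0`. -/
def NatExpr.eval (M : Store) : NatExpr → ℕ
  | .const k => k
  | .reg i => M.reg i
  | .arr a e => M.arr a (e.eval M)
  | .add e f => e.eval M + f.eval M
  | .sub e f => e.eval M - f.eval M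
  | .mul e f => e.eval M * f.eval M
  | .div e f => e.eval M / f.eval M
  | .lt e f => if e.eval M < f.eval M then 1 else 0
  | .eq e f => if e.eval M = f.eval M then 1 else 0

/-- The cost of evaluating an expression: one, plus the bit length of the value, for every
subexpression. -/
def NatExpr.cost (M : Store) : NatExpr → ℕ
  | .const k => 1 + k.size
  | .reg i => 1 + (M.reg i).size
  | .arr a e => e.cost M + 1 + (M.arr a (e.eval M)).size
  | .add e f => e.cost M + f.cost M + 1 + (e.eval M + f.eval M).size
  | .sub e f => e.cost M + f.cost M + 1 + (e.eval M - f.eval M).size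
  | .mul e f => e.cost M + f.cost M + 1 + (e.eval M * f.eval M).size
  | .div e f => e.cost M + f.cost M + 1 + (e.eval M / f.eval M).size
  | .lt e f => e.cost M + f.cost M + 2
  | .eq e f => e.cost M + f.cost M + 2

/-- Real expressions; `ofNat e` is the natural number `e` as a real number. -/
inductive RealExpr where
  | ofNat : NatExpr → RealExpr
  | arr : ℕ → NatExpr → RealExpr
  | add : RealExpr → RealExpr → RealExpr
  | sub : RealExpr → RealExpr → RealExpr
  | mul : RealExpr → RealExpr → RealExpr
  | div : RealExpr → RealExpr → RealExpr

/-- The value of a real expression. -/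
def RealExpr.eval (M : Store) : RealExpr → ℝ
  | .ofNat e => (e.eval M : ℝ)
  | .arr a e => M.rarr a (e.eval M)
  | .add e f => e.eval M + f.eval M
  | .sub e f => e.eval M - f.eval M
  | .mul e f => e.eval M * f.eval M
  | .div e f => e.eval M / f.eval M

/-- The cost of evaluating a real expression. -/
def RealExpr.cost (M : Store) : RealExpr → ℕ
  | .ofNat e => e.cost M + 1
  | .arr _ e => e.cost M + 1
  | .add e f => e.cost M + f.cost M + 1
  | .sub e f => e.cost M + f.cost M + 1
  | .mul e f => e.cost M + f.cost M + 1
  | .div e f => e.cost M + f.cost M + 1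

/-- Programs. -/
inductive Program where
  /-- set a register -/
  | assign : ℕ → NatExpr → Program
  /-- set the entry of an array at an index -/
  | store : ℕ → NatExpr → NatExpr → Program
  /-- set the entry of a real array at an index -/
  | rstore : ℕ → NatExpr → RealExpr → Program
  | seq : Program → Program → Program
  /-- branch on whether the expression is nonzero -/
  | cond : NatExpr → Program → Program → Program
  /-- repeat as long as the expression is nonzero -/
  | loop : NatExpr → Program → Program

/-- `Exec P M c M'`: started in the store `M`, the program `P` halts in the store `M'`, and the
run has the total cost `c`. -/
inductive Exec : Program → Store → ℕ → Store → Prop where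
  | assign (i : ℕ) (e : NatExpr) (M : Store) :
      Exec (.assign i e) M (e.cost M + 1)
        (M.setReg i (e.eval M))
  | store (a : ℕ) (e f : NatExpr) (M : Store) :
      Exec (.store a e f) M (e.cost M + f.cost M + 1)
        (M.setArr a (e.eval M) (f.eval M))
  | rstore (a : ℕ) (e : NatExpr) (f : RealExpr) (M : Store) :
      Exec (.rstore a e f) M (e.cost M + f.cost M + 1)
        (M.setRarr a (e.eval M) (f.eval M))
  | seq {P Q : Program} {M M' M'' : Store} {c c' : ℕ} :
      Exec P M c M' → Exec Q M' c' M'' → Exec (.seq P Q) M (c + c') M''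
  | cond_true {e : NatExpr} {P Q : Program} {M M' : Store} {c : ℕ} :
      e.eval M ≠ 0 → Exec P M c M' → Exec (.cond e P Q) M (e.cost M + 1 + c) M'
  | cond_false {e : NatExpr} {P Q : Program} {M M' : Store} {c : ℕ} :
      e.eval M = 0 → Exec Q M c M' → Exec (.cond e P Q) M (e.cost M + 1 + c) M'
  | loop_stop {e : NatExpr} {P : Program} {M : Store} :
      e.eval M = 0 → Exec (.loop e P) M (e.cost M + 1) M
  | loop_step {e : NatExpr} {P : Program} {M M' M'' : Store} {c c' : ℕ} :
      e.eval M ≠ 0 → Exec P M c M' → Exec (.loop e P) M' c' M'' →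
      Exec (.loop e P) M (e.cost M + 1 + c + c') M''

/-- The initial store: register `0` holds the level `m`, real array `0` holds the weights, and
everything else is zero. -/
def initialStore {n : ℕ} (w : Fin n → ℝ) (m : ℕ) : Store where
  reg := fun i => if i = 0 then m else 0
  arr := fun _ _ => 0
  rarr := fun a k => if h : a = 0 ∧ k < n then w ⟨k, h.2⟩ else 0

/-- The store holds the data of the `m`-th reduced program: register `0` holds the number `D` of
basis vectors; row `k` of array `0` (`2 ^ ℓ` entries, bit strings being read as binary numbers)
holds the occupation numbers of the `k`-th basis vector, where every basis vector is listed
exactly once; real arrays `1` and `2` hold the reduced matrix and the Gram matrix, row by row. -/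
def HoldsReducedProgram {n ℓ : ℕ} (S : Fin n → PauliString ℓ) (w : Fin n → ℝ) (m : ℕ)
    (M : Store) : Prop :=
  ∃ e : Fin (M.reg 0) ≃ Sym (Bits ℓ) (m + 2),
    (∀ (k : Fin (M.reg 0)) (a : Bits ℓ),
      M.arr 0 (k * 2 ^ ℓ + (finFunctionFinEquiv a : ℕ)) =
        Multiset.count a (e k : Multiset (Bits ℓ))) ∧
    ∀ k l : Fin (M.reg 0),
      (M.rarr 1 (k * M.reg 0 + l) : ℂ) = reducedMatrix S w m (e k) (e l) ∧
      (M.rarr 2 (k * M.reg 0 + l) : ℂ) = gramMatrix ℓ m (e k) (e l)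

end

end BoseHierarchy

open BoseHierarchy

/-! The objective is linear in σ, so it is maximized at a unit vector `v` of the symmetric subspace:
c^(m) is the top of a quadratic form on its unit sphere (`exists_isGreatest_extensionValues`).
Product vectors ψ^{⊗(m+2)} give the values ∑ w_i ⟨ψ, S_i ψ⟩², and convexity in ρ reduces β to pure
states, whence β ≤ c^(m). Slicing `v` along its last factor gives vectors of the previous level
whose squared norms add up; this is monotonicity in m.

Convergence is a de Finetti estimate obtained by bosonic quantization. Put N = m + 2 and encode `v`
as the homogeneous polynomial f(z) = ∑ v_x ∏ z_{x_k}. In the Bargmann-Fock space (Gaussian measure γ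
on ℂ^d) multiplication by z_a is adjoint to ∂_a, and f has squared norm N! |v|². For Hermitian A let
Q(A) = ∫ |f(z)|² ⟨z̄, A z̄⟩² dγ(z), which is `antiWick A f`. The pointwise bound ∑ w_i ⟨z̄, S_i z̄⟩²
≤ β |z|⁴ integrates to ∑ w_i Q(S_i) ≤ β Q(1) (`sum_antiWick_le`). Commuting derivatives past
multiplications evaluates Q(A) when A² = 1 (`antiWick_symPoly`): it is N! N(N-1) ⟨v, (A⊗A⊗1) v⟩ plus
a multiple of |v|², which is nonnegative for a Pauli string because such a string is the identity or
traceless. Moreover Q(1) = N! (N+d)(N+d+1) |v|². Hence N(N-1) c^(m) ≤ β (N+d)(N+d+1)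
(`extensionBound_mul_le`), and β ≤ c^(m) ≤ ∑ w_i turns this into the rate.

For the reduced programs, the vectors v_s span the symmetric subspace because a polynomial vanishing
everywhere is zero. The matrix entries count sequences, hence are multinomial coefficients weighted
by the w_i and by products of two entries of one Pauli string, which are integers. With ℓ fixed
there are only (m+3)^d candidate occupation vectors, read as d-digit numbers in base m+3; one loop
enumerates them, and another fills the matrices. All integers stay below a polynomial in m, hence so
does the cost. -/

namespace BoseHierarchy

/-! ### Quadratic forms and rank-one decompositions -/

section QuadraticForms

variable {ι : Type} [Fintype ι]

/-- The real part of `⟨v, A v⟩`. -/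
noncomputable def quadForm (A : Matrix ι ι ℂ) (v : ι → ℂ) : ℝ :=
  (star v ⬝ᵥ A.mulVec v).re

/-- The square of the Euclidean norm. -/
noncomputable def normSq (v : ι → ℂ) : ℝ := ∑ i, Complex.normSq (v i)

theorem star_dotProduct_self (v : ι → ℂ) : star v ⬝ᵥ v = (normSq v : ℂ) := by
  simp only [dotProduct, normSq, Complex.ofReal_sum, Pi.star_apply]
  refine Finset.sum_congr rfl fun i _ => ?_
  rw [← Complex.mul_conj, mul_comm]; rfl

theorem normSq_nonneg (v : ι → ℂ) : 0 ≤ normSq v :=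
  Finset.sum_nonneg fun _ _ => Complex.normSq_nonneg _

theorem normSq_eq_zero {v : ι → ℂ} : normSq v = 0 ↔ v = 0 := by
  rw [normSq, Finset.sum_eq_zero_iff_of_nonneg fun _ _ => Complex.normSq_nonneg _]
  simp [funext_iff]

theorem normSq_smul (c : ℂ) (v : ι → ℂ) : normSq (c • v) = Complex.normSq c * normSq v := by
  simp [normSq, Finset.mul_sum]

theorem quadForm_smul (A : Matrix ι ι ℂ) (c : ℂ) (v : ι → ℂ) :
    quadForm A (c • v) = Complex.normSq c * quadForm A v := by
  have : star (c • v) ⬝ᵥ A.mulVec (c • v) =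
      (Complex.normSq c : ℂ) * (star v ⬝ᵥ A.mulVec v) := by
    rw [Matrix.mulVec_smul, star_smul, smul_dotProduct, dotProduct_smul, ← Complex.mul_conj]
    simp only [smul_eq_mul, RCLike.star_def]; ring
  rw [quadForm, this, Complex.re_ofReal_mul]; rfl

theorem trace_vecMulVec_mul (u : ι → ℂ) (A : Matrix ι ι ℂ) :
    (Matrix.vecMulVec u (star u) * A).trace = star u ⬝ᵥ A.mulVec u := by
  rw [Matrix.vecMulVec_mul, Matrix.trace_vecMulVec, dotProduct_comm, Matrix.dotProduct_mulVec]

/-- A positive semidefinite matrix is a sum of rank-one projectors onto vectors in its range. -/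
theorem posSemidef_eq_sum [DecidableEq ι] {X : Matrix ι ι ℂ} (hX : X.PosSemidef) :
    ∃ u : ι → ι → ℂ, (∀ k, ∃ y, X.mulVec y = u k) ∧
      X = ∑ k, Matrix.vecMulVec (u k) (star (u k)) := by
  classical
  set b := hX.1.eigenvectorBasis
  set ev := hX.1.eigenvalues
  have hev : ∀ k, 0 ≤ ev k := hX.eigenvalues_nonneg
  have hb : ∀ k, X.mulVec (b k) = ev k • (b k : ι → ℂ) := hX.1.mulVec_eigenvectorBasis
  -- The vectors are √λ_k b_k for an orthonormal eigenbasis; each is zero or the image of b_k /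
  -- √λ_k, hence in the range of `X`.
  refine ⟨fun k => ((Real.sqrt (ev k) : ℝ) : ℂ) • (b k : ι → ℂ), fun k => ?_, ?_⟩
  · rcases (hev k).eq_or_lt with h | h
    · exact ⟨0, by simp [← h]⟩
    · refine ⟨((Real.sqrt (ev k) : ℝ) : ℂ)⁻¹ • (b k : ι → ℂ), ?_⟩
      rw [Matrix.mulVec_smul, hb k, ← Complex.coe_smul, smul_smul]
      congr 1
      have h2 : ((Real.sqrt (ev k) : ℝ) : ℂ) ≠ 0 := by
        simpa using (Real.sqrt_pos.2 h).ne'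
      field_simp
      rw [← Complex.ofReal_pow, Real.sq_sqrt (hev k)]
  · ext i j
    have h := congrFun (congrFun hX.1.spectral_theorem i) j
    rw [h, Unitary.conjStarAlgAut_apply, Matrix.mul_apply, Matrix.sum_apply]
    refine Finset.sum_congr rfl fun k _ => ?_
    rw [Matrix.mul_diagonal, Matrix.star_apply, Matrix.IsHermitian.eigenvectorUnitary_apply,
      Matrix.IsHermitian.eigenvectorUnitary_apply, Matrix.vecMulVec_apply]
    have h2 : ((ev k : ℝ) : ℂ) = ((Real.sqrt (ev k) : ℝ) : ℂ) * ((Real.sqrt (ev k) : ℝ) : ℂ) := by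
      rw [← Complex.ofReal_mul, Real.mul_self_sqrt (hev k)]
    simp only [Function.comp, Pi.smul_apply, Pi.star_apply, smul_eq_mul, star_mul']
    change _ * ((ev k : ℝ) : ℂ) * _ = _
    rw [h2]
    simp only [RCLike.star_def, Complex.conj_ofReal, b]
    ring

theorem trace_mul_of_eq_sum {X : Matrix ι ι ℂ} {u : ι → ι → ℂ}
    (h : X = ∑ k, Matrix.vecMulVec (u k) (star (u k))) (A : Matrix ι ι ℂ) :
    (X * A).trace = ∑ k, star (u k) ⬝ᵥ A.mulVec (u k) := by
  rw [h, Finset.sum_mul, Matrix.trace_sum]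
  exact Finset.sum_congr rfl fun k _ => trace_vecMulVec_mul _ _

theorem re_trace_mul_of_eq_sum {X : Matrix ι ι ℂ} {u : ι → ι → ℂ}
    (h : X = ∑ k, Matrix.vecMulVec (u k) (star (u k))) (A : Matrix ι ι ℂ) :
    (X * A).trace.re = ∑ k, quadForm A (u k) := by
  rw [trace_mul_of_eq_sum h, Complex.re_sum]; rfl

theorem trace_of_eq_sum {X : Matrix ι ι ℂ} {u : ι → ι → ℂ}
    (h : X = ∑ k, Matrix.vecMulVec (u k) (star (u k))) :
    X.trace = ((∑ k, normSq (u k) : ℝ) : ℂ) := by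
  classical
  have := trace_mul_of_eq_sum h 1
  simp only [mul_one, Matrix.one_mulVec, star_dotProduct_self] at this
  rw [this, Complex.ofReal_sum]

theorem isState_vecMulVec {v : ι → ℂ} (hv : normSq v = 1) :
    IsState (Matrix.vecMulVec v (star v)) := by
  refine ⟨Matrix.posSemidef_vecMulVec_self_star v, ?_⟩
  rw [Matrix.trace_vecMulVec, dotProduct_comm, star_dotProduct_self, hv, Complex.ofReal_one]

theorem expect_vecMulVec (v : ι → ℂ) (A : Matrix ι ι ℂ) :
    expect (Matrix.vecMulVec v (star v)) A = quadForm A v := by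
  rw [expect, trace_vecMulVec_mul]; rfl

theorem continuous_normSq : Continuous (normSq : (ι → ℂ) → ℝ) := by
  unfold normSq
  exact continuous_finsetSum _ fun i _ => Complex.continuous_normSq.comp (continuous_apply i)

theorem continuous_quadForm (A : Matrix ι ι ℂ) : Continuous (quadForm A) := by
  unfold quadForm dotProduct Matrix.mulVec dotProduct
  simp only [Pi.star_apply]
  fun_prop

/-- The unit vector in the direction of `v`. -/
theorem exists_unit_multiple {v : ι → ℂ} (hv : v ≠ 0) :
    ∃ c : ℂ, Complex.normSq c * normSq v = 1 := by
  have h : 0 < normSq v := (normSq_nonneg v).lt_of_ne fun h => hv (normSq_eq_zero.1 h.symm)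
  refine ⟨((Real.sqrt (normSq v))⁻¹ : ℝ), ?_⟩
  rw [Complex.normSq_ofReal, ← mul_inv, Real.mul_self_sqrt h.le, inv_mul_cancel₀ h.ne']

/-- A Hermitian form attains its maximum on the unit sphere of a nonzero subspace. -/
theorem exists_max_quadForm (A : Matrix ι ι ℂ) {W : Submodule ℂ (ι → ℂ)} (hW : W ≠ ⊥) :
    ∃ c : ℝ, (∀ v ∈ W, quadForm A v ≤ c * normSq v) ∧
      ∃ v ∈ W, normSq v = 1 ∧ quadForm A v = c := by
  have hcl : IsClosed {v : ι → ℂ | v ∈ W ∧ normSq v = 1} :=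
    W.closed_of_finiteDimensional.inter (isClosed_eq continuous_normSq continuous_const)
  have hcpt : IsCompact {v : ι → ℂ | v ∈ W ∧ normSq v = 1} := by
    refine (isCompact_closedBall (0 : ι → ℂ) 1).of_isClosed_subset hcl fun v hv => ?_
    rw [mem_closedBall_zero_iff, pi_norm_le_iff_of_nonneg zero_le_one]
    intro i
    have : Complex.normSq (v i) ≤ normSq v :=
      Finset.single_le_sum (f := fun i => Complex.normSq (v i))
        (fun _ _ => Complex.normSq_nonneg _) (Finset.mem_univ i)
    rw [hv.2, Complex.normSq_eq_norm_sq] at this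
    exact (sq_le_one_iff₀ (norm_nonneg _)).1 this
  obtain ⟨v₀, hv₀, hne⟩ := (Submodule.ne_bot_iff W).1 hW
  obtain ⟨c₀, hc₀⟩ := exists_unit_multiple hne
  obtain ⟨v, hv, hmax⟩ := hcpt.exists_isMaxOn ⟨c₀ • v₀, W.smul_mem _ hv₀, by rwa [normSq_smul]⟩
    (continuous_quadForm A).continuousOn
  refine ⟨quadForm A v, fun u hu => ?_, v, hv.1, hv.2, rfl⟩
  by_cases hu0 : u = 0
  · subst hu0; simp [quadForm, normSq]
  obtain ⟨c, hc⟩ := exists_unit_multiple hu0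
  have h := hmax (show c • u ∈ {v : ι → ℂ | v ∈ W ∧ normSq v = 1} from
    ⟨W.smul_mem _ hu, by rwa [normSq_smul]⟩)
  simp only [Set.mem_ofPred_eq, quadForm_smul] at h
  have hpos : 0 ≤ normSq u := normSq_nonneg u
  calc quadForm A u = (Complex.normSq c * quadForm A u) * normSq u := by
        rw [mul_right_comm, hc, one_mul]
    _ ≤ quadForm A v * normSq u := mul_le_mul_of_nonneg_right h hpos

end QuadraticForms

/-! ### The symmetric subspace and its occupation number basis -/

section SymmetricSubspace

variable {ι : Type}

theorem occupation_coe {N : ℕ} (x : Fin N → ι) :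
    (occupation x : Multiset ι) = Finset.univ.val.map x := rfl

theorem occupation_cons {N : ℕ} (a : ι) (x : Fin N → ι) :
    occupation (Fin.cons a x : Fin (N + 1) → ι) = a ::ₛ occupation x := by
  apply Sym.ext
  rw [Sym.coe_cons, occupation_coe, occupation_coe, Fin.univ_val_map, Fin.univ_val_map]
  simp [List.ofFn_succ]

theorem occupation_snoc {N : ℕ} (a : ι) (x : Fin N → ι) :
    occupation (Fin.snoc x a : Fin (N + 1) → ι) = a ::ₛ occupation x := by
  apply Sym.ext
  rw [Sym.coe_cons, occupation_coe, occupation_coe, Fin.univ_val_map, Fin.univ_val_map]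
  rw [List.ofFn_succ']
  simp

theorem occupation_surjective {N : ℕ} :
    Function.Surjective (occupation : (Fin N → ι) → Sym ι N) := by
  induction N with
  | zero => exact fun s => ⟨Fin.elim0, Subsingleton.elim _ _⟩
  | succ N ih =>
    intro s
    obtain ⟨a, s', rfl⟩ := s.exists_eq_cons_of_succ
    obtain ⟨x, rfl⟩ := ih s'
    exact ⟨Fin.cons a x, occupation_cons a x⟩

theorem prod_eq_prod_occupation {R : Type*} [CommMonoid R] {N : ℕ} (ψ : ι → R) (x : Fin N → ι) :
    ∏ k, ψ (x k) = ((occupation x : Multiset ι).map ψ).prod := by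
  rw [occupation_coe, Multiset.map_map]; rfl

theorem multiset_prod_X [DecidableEq ι] (s : Multiset ι) :
    (s.map (MvPolynomial.X : ι → MvPolynomial ι ℂ)).prod =
      MvPolynomial.monomial (Multiset.toFinsupp s) 1 := by
  induction s using Multiset.induction_on with
  | empty => simp
  | cons a s ih =>
    rw [Multiset.map_cons, Multiset.prod_cons, ih, ← Multiset.singleton_add, Multiset.toFinsupp_add,
      Multiset.toFinsupp_singleton, MvPolynomial.X, MvPolynomial.monomial_mul, one_mul]

theorem linearIndependent_dickeVector [DecidableEq ι] (N : ℕ) :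
    LinearIndependent ℂ (dickeVector : Sym ι N → (Fin N → ι) → ℂ) := by
  rw [linearIndependent_iff']
  intro F g hg s hs
  obtain ⟨x, rfl⟩ := occupation_surjective s
  have := congrFun hg x
  simpa [dickeVector, Finset.sum_apply, hs] using this

theorem sum_eq_sum_cons {R : Type*} [AddCommMonoid R] [Fintype ι] {N : ℕ}
    (f : (Fin (N + 1) → ι) → R) :
    ∑ x, f x = ∑ a, ∑ x : Fin N → ι, f (Fin.cons a x : Fin (N + 1) → ι) := by
  rw [← (Fin.consEquiv fun _ => ι).sum_comp, Fintype.sum_prod_type]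
  rfl

theorem sum_eq_sum_snoc {R : Type*} [AddCommMonoid R] [Fintype ι] {N : ℕ}
    (f : (Fin (N + 1) → ι) → R) :
    ∑ x, f x = ∑ a, ∑ x : Fin N → ι, f (Fin.snoc x a : Fin (N + 1) → ι) := by
  rw [← (Fin.snocEquiv fun _ => ι).sum_comp, Fintype.sum_prod_type]
  rfl

variable [Fintype ι] [DecidableEq ι]

theorem sum_smul_dickeVector {N : ℕ} (g : Sym ι N → ℂ) (x : Fin N → ι) :
    (∑ s, g s • dickeVector s) x = g (occupation x) := by
  simp [dickeVector, Finset.sum_apply]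

/-- Duality: a functional φ that kills every ψ^{⊗N} makes ∑_t φ(v_t) ψ^t vanish for all ψ. Over an
infinite field the polynomial itself is then zero, so each coefficient φ(v_s) is zero, and no
functional can separate v_s from the span. -/
theorem dickeVector_mem_symSubspace {N : ℕ} (s : Sym ι N) :
    dickeVector s ∈ symSubspace ι N := by
  by_contra hs
  obtain ⟨φ, hφ, hle⟩ := Submodule.exists_le_ker_of_notMem hs
  apply hφ
  have hp : ∑ t : Sym ι N, MvPolynomial.C (φ (dickeVector t)) *
      ((t : Multiset ι).map (MvPolynomial.X : ι → MvPolynomial ι ℂ)).prod = 0 := by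
    apply MvPolynomial.funext
    intro ψ
    have h0 : φ (fun x : Fin N → ι => ∏ k, ψ (x k)) = 0 :=
      hle (Submodule.subset_span ⟨ψ, rfl⟩)
    have h1 : (fun x : Fin N → ι => ∏ k, ψ (x k)) =
        ∑ t : Sym ι N, ((t : Multiset ι).map ψ).prod • dickeVector t := by
      funext x
      rw [sum_smul_dickeVector fun t : Sym ι N => ((t : Multiset ι).map ψ).prod]
      exact prod_eq_prod_occupation ψ x
    rw [h1, map_sum] at h0
    rw [map_sum, map_zero, ← h0]
    refine Finset.sum_congr rfl fun t _ => ?_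
    rw [map_mul, MvPolynomial.eval_C, map_multiset_prod, Multiset.map_map, map_smul, smul_eq_mul,
      mul_comm]
    simp
  have hc := congrArg (MvPolynomial.coeff (Multiset.toFinsupp (s : Multiset ι))) hp
  rw [MvPolynomial.coeff_sum, MvPolynomial.coeff_zero] at hc
  rw [← hc, Finset.sum_eq_single s]
  · rw [multiset_prod_X, MvPolynomial.coeff_C_mul, MvPolynomial.coeff_monomial, if_pos rfl, mul_one]
  · intro t _ hts
    rw [multiset_prod_X, MvPolynomial.coeff_C_mul, MvPolynomial.coeff_monomial, if_neg, mul_zero]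
    exact fun h => hts (Sym.ext (Multiset.toFinsupp.injective h))
  · simp

/-- The working description of the symmetric subspace: coefficients that depend on the occupation
only. Stability under slicing and exchange of entries can be read off from it. -/
theorem mem_symSubspace_iff {N : ℕ} {v : (Fin N → ι) → ℂ} :
    v ∈ symSubspace ι N ↔ ∃ g : Sym ι N → ℂ, ∀ x, v x = g (occupation x) := by
  constructor
  · intro hv
    induction hv using Submodule.span_induction with
    | mem v hv =>
      obtain ⟨ψ, rfl⟩ := hv
      exact ⟨fun s => ((s : Multiset ι).map ψ).prod, fun x => prod_eq_prod_occupation ψ x⟩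
    | zero => exact ⟨0, fun _ => rfl⟩
    | add u v _ _ hu hv =>
      obtain ⟨g, hg⟩ := hu
      obtain ⟨g', hg'⟩ := hv
      exact ⟨g + g', fun x => by simp [hg, hg']⟩
    | smul c v _ hv =>
      obtain ⟨g, hg⟩ := hv
      exact ⟨c • g, fun x => by simp [hg]⟩
  · rintro ⟨g, hg⟩
    have : v = ∑ s, g s • dickeVector s := by
      funext x; rw [sum_smul_dickeVector, hg]
    rw [this]
    exact Submodule.sum_mem _ fun s _ => Submodule.smul_mem _ _ (dickeVector_mem_symSubspace s)

theorem exists_sum_smul_dickeVector {N : ℕ} {v : (Fin N → ι) → ℂ} (hv : v ∈ symSubspace ι N) :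
    ∃ g : Sym ι N → ℂ, v = ∑ s, g s • dickeVector s := by
  obtain ⟨g, hg⟩ := mem_symSubspace_iff.1 hv
  exact ⟨g, by funext x; rw [sum_smul_dickeVector, hg]⟩

theorem span_dickeVector (N : ℕ) :
    Submodule.span ℂ (Set.range (dickeVector : Sym ι N → (Fin N → ι) → ℂ)) = symSubspace ι N := by
  apply le_antisymm
  · rw [Submodule.span_le]
    rintro _ ⟨s, rfl⟩
    exact dickeVector_mem_symSubspace s
  · intro v hv
    obtain ⟨g, rfl⟩ := exists_sum_smul_dickeVector hv
    exact Submodule.sum_mem _ fun s _ =>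
      Submodule.smul_mem _ _ (Submodule.subset_span ⟨s, rfl⟩)

theorem symSubspace_ne_bot [Nonempty ι] (N : ℕ) : symSubspace ι N ≠ ⊥ := by
  rw [Submodule.ne_bot_iff]
  let x : Fin N → ι := fun _ => Classical.arbitrary ι
  refine ⟨dickeVector (occupation x), dickeVector_mem_symSubspace _, fun h => ?_⟩
  simpa [dickeVector] using congrFun h x

theorem slice_mem_symSubspace {N : ℕ} {v : (Fin (N + 1) → ι) → ℂ}
    (hv : v ∈ symSubspace ι (N + 1)) (a : ι) :
    (fun x : Fin N → ι => v (Fin.cons a x : Fin (N + 1) → ι)) ∈ symSubspace ι N := by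
  obtain ⟨g, hg⟩ := mem_symSubspace_iff.1 hv
  exact mem_symSubspace_iff.2 ⟨fun s => g (a ::ₛ s), fun x => by rw [hg, occupation_cons]⟩

theorem slice_last_mem_symSubspace {N : ℕ} {v : (Fin (N + 1) → ι) → ℂ}
    (hv : v ∈ symSubspace ι (N + 1)) (a : ι) :
    (fun x : Fin N → ι => v (Fin.snoc x a : Fin (N + 1) → ι)) ∈ symSubspace ι N := by
  obtain ⟨g, hg⟩ := mem_symSubspace_iff.1 hv
  exact mem_symSubspace_iff.2 ⟨fun s => g (a ::ₛ s), fun x => by rw [hg, occupation_snoc]⟩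

theorem cons_cons_comm_of_mem_symSubspace {N : ℕ} {v : (Fin (N + 2) → ι) → ℂ}
    (hv : v ∈ symSubspace ι (N + 2)) (a b : ι) (x : Fin N → ι) :
    v (Fin.cons a (Fin.cons b x : Fin (N + 1) → ι) : Fin (N + 2) → ι) =
      v (Fin.cons b (Fin.cons a x : Fin (N + 1) → ι) : Fin (N + 2) → ι) := by
  obtain ⟨g, hg⟩ := mem_symSubspace_iff.1 hv
  rw [hg, hg]
  simp only [occupation_cons]
  rw [Sym.cons_swap]

/-- The number of sequences with given occupation numbers is a multinomial coefficient. -/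
theorem card_occupation_mul_prod_factorial {N : ℕ} (s : Sym ι N) :
    (Finset.univ.filter fun x : Fin N → ι => occupation x = s).card *
      ∏ a, ((s : Multiset ι).count a).factorial = N.factorial := by
  induction N with
  | zero =>
    have : ∀ a, (s : Multiset ι).count a = 0 := by
      intro a; rw [Sym.eq_nil_of_card_zero s]; simp
    simp [this, Subsingleton.elim _ s]
  | succ N ih =>
    have h1 : (Finset.univ.filter fun x : Fin (N + 1) → ι => occupation x = s).card =
        ∑ a, (Finset.univ.filter fun x : Fin N → ι => a ::ₛ occupation x = s).card := by
      simp only [Finset.card_filter]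
      rw [sum_eq_sum_cons]
      simp only [occupation_cons]
    -- Sequences are sorted by their first entry `a`. Removing one `a` from `s` divides the product
    -- of factorials by the multiplicity of `a`, and the multiplicities sum to N + 1.
    have h2 : ∀ a, (Finset.univ.filter fun x : Fin N → ι => a ::ₛ occupation x = s).card *
        ∏ b, ((s : Multiset ι).count b).factorial = (s : Multiset ι).count a * N.factorial := by
      intro a
      by_cases ha : a ∈ s
      · obtain ⟨t, rfl⟩ := Sym.exists_cons_of_mem ha
        simp only [Sym.cons_inj_right]
        rw [← ih t, ← Finset.mul_prod_erase _ _ (Finset.mem_univ a),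
          ← Finset.mul_prod_erase _ (fun b => ((t : Multiset ι).count b).factorial)
            (Finset.mem_univ a)]
        rw [Sym.coe_cons, Multiset.count_cons_self, Nat.factorial_succ,
          Finset.prod_congr rfl (g := fun b => ((t : Multiset ι).count b).factorial)]
        · ring
        · intro b hb
          rw [Multiset.count_cons_of_ne (Finset.ne_of_mem_erase hb)]
      · rw [Finset.filter_false_of_mem, Finset.card_empty, zero_mul,
          Multiset.count_eq_zero_of_notMem, zero_mul]
        · simpa using ha
        · rintro x - rfl
          exact ha (Sym.mem_cons_self a _)
    rw [h1, Finset.sum_mul, Finset.sum_congr rfl fun a _ => h2 a, ← Finset.sum_mul,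
      Multiset.sum_count_eq_card fun a _ => Finset.mem_univ a, Sym.card_coe, Nat.factorial_succ]

end SymmetricSubspace

/-! ### Algebra of Pauli strings -/

section PauliStrings

theorem Pauli.mat_conjTranspose (p : Pauli) : p.mat.conjTranspose = p.mat := by
  cases p <;> ext i j <;> fin_cases i <;> fin_cases j <;> simp [Pauli.mat]

theorem Pauli.mat_mul_self (p : Pauli) : p.mat * p.mat = 1 := by
  cases p <;> ext i j <;> fin_cases i <;> fin_cases j <;> simp [Pauli.mat, Matrix.mul_apply]

theorem Pauli.trace_mat_of_ne {p : Pauli} (hp : p ≠ Pauli.I) : p.mat.trace = 0 := by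
  cases p <;> simp_all [Pauli.mat, Matrix.trace, Fin.sum_univ_two]

variable {ℓ : ℕ}

theorem PauliString.mat_apply (s : PauliString ℓ) (x y : Bits ℓ) :
    s.mat x y = ∏ k, (s k).mat (x k) (y k) := rfl

theorem PauliString.mat_isHermitian (s : PauliString ℓ) : s.mat.IsHermitian := by
  ext x y
  rw [Matrix.conjTranspose_apply, PauliString.mat, PauliString.mat, star_prod]
  refine Finset.prod_congr rfl fun k _ => ?_
  rw [← Matrix.conjTranspose_apply, Pauli.mat_conjTranspose]

theorem prod_one_apply (x y : Bits ℓ) :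
    ∏ k, (1 : Matrix (Fin 2) (Fin 2) ℂ) (x k) (y k) = (1 : Matrix (Bits ℓ) (Bits ℓ) ℂ) x y := by
  rcases eq_or_ne x y with rfl | h
  · simp
  · obtain ⟨k, hk⟩ := Function.ne_iff.1 h
    rw [Matrix.one_apply_ne h]
    exact Finset.prod_eq_zero (Finset.mem_univ k) (Matrix.one_apply_ne hk)

theorem PauliString.mat_mul_self (s : PauliString ℓ) : s.mat * s.mat = 1 := by
  ext x y
  simp only [Matrix.mul_apply, PauliString.mat_apply, ← Finset.prod_mul_distrib]
  rw [← prod_one_apply,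
    Finset.prod_congr rfl fun k _ => congrFun₂ (Pauli.mat_mul_self (s k)).symm (x k) (y k)]
  simp only [Matrix.mul_apply]
  exact (Fintype.prod_sum fun k j => (s k).mat (x k) j * (s k).mat j (y k)).symm

theorem PauliString.trace_mat (s : PauliString ℓ) : s.mat.trace = ∏ k, (s k).mat.trace := by
  simp only [Matrix.trace, Matrix.diag, PauliString.mat]
  exact (Fintype.prod_sum fun k j => (s k).mat j j).symm

/-- A Pauli string is the identity or traceless. -/
theorem PauliString.mat_eq_one_or_trace_eq_zero (s : PauliString ℓ) :
    s.mat = 1 ∨ s.mat.trace = 0 := by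
  by_cases h : ∀ k, s k = Pauli.I
  · left
    ext x y
    rw [PauliString.mat, ← prod_one_apply]
    refine Finset.prod_congr rfl fun k _ => ?_
    rw [h k, Pauli.mat, Matrix.one_fin_two]
  · right
    push Not at h
    obtain ⟨k, hk⟩ := h
    rw [PauliString.trace_mat]
    exact Finset.prod_eq_zero (Finset.mem_univ k) (Pauli.trace_mat_of_ne hk)

end PauliStrings

/-! ### Hermitian involutions -/

section Involutions

variable {ι : Type} [Fintype ι]

theorem ofReal_quadForm {A : Matrix ι ι ℂ} (hA : A.IsHermitian) (v : ι → ℂ) :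
    (quadForm A v : ℂ) = star v ⬝ᵥ A.mulVec v := by
  rw [quadForm]
  apply Complex.conj_eq_iff_re.1
  change star _ = _
  rw [← Matrix.star_dotProduct_star, star_star, Matrix.star_mulVec, hA.eq,
    ← Matrix.dotProduct_mulVec]

variable [DecidableEq ι]

/-- Expand 0 ≤ |v - A v|² and use |A v| = |v|. -/
theorem quadForm_le_normSq {A : Matrix ι ι ℂ} (hA : A.IsHermitian) (h1 : A * A = 1)
    (v : ι → ℂ) : quadForm A v ≤ normSq v := by
  have h2 : star (A.mulVec v) ⬝ᵥ A.mulVec v = star v ⬝ᵥ v := by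
    rw [Matrix.star_mulVec, hA.eq, ← Matrix.dotProduct_mulVec, Matrix.mulVec_mulVec, h1,
      Matrix.one_mulVec]
  have h3 : star (A.mulVec v) ⬝ᵥ v = star v ⬝ᵥ A.mulVec v := by
    rw [Matrix.star_mulVec, hA.eq, ← Matrix.dotProduct_mulVec]
  have h4 := star_dotProduct_self (v - A.mulVec v)
  rw [star_sub, sub_dotProduct, dotProduct_sub, dotProduct_sub, h2, h3, star_dotProduct_self] at h4
  have h5 := congrArg Complex.re h4
  simp only [Complex.sub_re, Complex.ofReal_re] at h5
  have h6 := normSq_nonneg (v - A.mulVec v)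
  change _ - quadForm A v - (quadForm A v - _) = _ at h5
  linarith

end Involutions

/-! ### Operators on the first two tensor factors -/

section ExtendOp

/-- Splitting off the first two entries of a sequence. -/
def splitTwo (ι : Type) (m : ℕ) : (Fin (m + 2) → ι) ≃ (ι × ι) × (Fin m → ι) where
  toFun x := ((x 0, x 1), fun k => x k.succ.succ)
  invFun p := (Fin.cons p.1.1 (Fin.cons p.1.2 p.2 : Fin (m + 1) → ι) : Fin (m + 2) → ι)
  left_inv x := by
    funext k
    refine Fin.cases ?_ (fun k => ?_) k
    · rfl
    · refine Fin.cases ?_ (fun k => ?_) k <;> rfl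
  right_inv p := rfl

theorem splitTwo_apply {ι : Type} {m : ℕ} (x : Fin (m + 2) → ι) :
    splitTwo ι m x = ((x 0, x 1), fun k => x k.succ.succ) := rfl

variable {ι : Type} [DecidableEq ι]

/-- Up to reindexing, the operator is a Kronecker product with the identity, so hermiticity and the
square are inherited from `H`. -/
theorem extendOp_eq_submatrix (m : ℕ) (H : Matrix (ι × ι) (ι × ι) ℂ) :
    extendOp m H = (H ⊗ₖ (1 : Matrix (Fin m → ι) (Fin m → ι) ℂ)).submatrix
      (splitTwo ι m) (splitTwo ι m) := by
  ext x y
  simp [extendOp, splitTwo_apply, Matrix.kroneckerMap_apply, Matrix.one_apply, funext_iff]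

theorem extendOp_isHermitian (m : ℕ) {H : Matrix (ι × ι) (ι × ι) ℂ} (hH : H.IsHermitian) :
    (extendOp m H).IsHermitian := by
  rw [extendOp_eq_submatrix]
  apply Matrix.IsHermitian.submatrix
  rw [Matrix.IsHermitian, Matrix.conjTranspose_kronecker, hH.eq, Matrix.conjTranspose_one]

variable [Fintype ι]

theorem extendOp_mul_self (m : ℕ) {H : Matrix (ι × ι) (ι × ι) ℂ} (hH : H * H = 1) :
    extendOp m H * extendOp m H = 1 := by
  rw [extendOp_eq_submatrix, Matrix.submatrix_mul_equiv, ← Matrix.mul_kronecker_mul, hH, one_mul,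
    Matrix.one_kronecker_one, Matrix.submatrix_one_equiv]

theorem dotProduct_extendOp (m : ℕ) (H : Matrix (ι × ι) (ι × ι) ℂ)
    (u v : (Fin (m + 2) → ι) → ℂ) :
    star u ⬝ᵥ (extendOp m H).mulVec v =
      ∑ r : Fin m → ι, ∑ p : ι × ι, ∑ q : ι × ι,
        star (u (Fin.cons p.1 (Fin.cons p.2 r : Fin (m + 1) → ι) : Fin (m + 2) → ι)) * H p q *
          v (Fin.cons q.1 (Fin.cons q.2 r : Fin (m + 1) → ι) : Fin (m + 2) → ι) := by
  simp only [dotProduct, Matrix.mulVec, Finset.mul_sum]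
  rw [← (splitTwo ι m).symm.sum_comp, Fintype.sum_prod_type, Finset.sum_comm]
  refine Finset.sum_congr rfl fun r _ => Finset.sum_congr rfl fun p _ => ?_
  rw [← (splitTwo ι m).symm.sum_comp, Fintype.sum_prod_type]
  refine Finset.sum_congr rfl fun q _ => ?_
  rw [Finset.sum_eq_single r]
  · rw [extendOp_eq_submatrix, Matrix.submatrix_apply, Equiv.apply_symm_apply,
      Equiv.apply_symm_apply, Matrix.kroneckerMap_apply, Matrix.one_apply_eq, mul_one, ← mul_assoc]
    rfl
  · intro r' _ h
    rw [extendOp_eq_submatrix, Matrix.submatrix_apply, Equiv.apply_symm_apply,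
      Equiv.apply_symm_apply, Matrix.kroneckerMap_apply, Matrix.one_apply_ne h.symm]
    simp
  · simp

end ExtendOp

/-! ### The extension programs and their reduced form -/

section Programs

variable {n ℓ : ℕ} (S : Fin n → PauliString ℓ) (w : Fin n → ℝ)

theorem extendOp_pairHamiltonian (m : ℕ) :
    extendOp m (pairHamiltonian S w) =
      ∑ i, (w i : ℂ) • extendOp m ((S i).mat ⊗ₖ (S i).mat) := by
  ext x y
  simp [extendOp, pairHamiltonian, Matrix.sum_apply]

theorem quadForm_extendOp_pairHamiltonian (m : ℕ) (v : (Fin (m + 2) → Bits ℓ) → ℂ) :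
    quadForm (extendOp m (pairHamiltonian S w)) v =
      ∑ i, w i * quadForm (extendOp m ((S i).mat ⊗ₖ (S i).mat)) v := by
  rw [extendOp_pairHamiltonian, quadForm, Matrix.sum_mulVec, dotProduct_sum, Complex.re_sum]
  refine Finset.sum_congr rfl fun i _ => ?_
  rw [Matrix.smul_mulVec, dotProduct_smul, smul_eq_mul, Complex.re_ofReal_mul, quadForm]

/-- Compactness of the unit sphere gives a maximizing vector. A feasible σ is a sum of rank-one
terms over vectors in its range, thus in the symmetric subspace, and their squared norms sum to one,
so mixed states do no better. -/
theorem exists_isGreatest_extensionValues (m : ℕ) :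
    ∃ c, IsGreatest (extensionValues S w m) c ∧
      (∀ v ∈ symSubspace (Bits ℓ) (m + 2),
        quadForm (extendOp m (pairHamiltonian S w)) v ≤ c * normSq v) ∧
      ∃ v ∈ symSubspace (Bits ℓ) (m + 2), normSq v = 1 ∧
        quadForm (extendOp m (pairHamiltonian S w)) v = c := by
  obtain ⟨c, hle, v, hv, hv1, hvc⟩ :=
    exists_max_quadForm (extendOp m (pairHamiltonian S w))
      (symSubspace_ne_bot (ι := Bits ℓ) (m + 2))
  refine ⟨c, ⟨⟨_, isState_vecMulVec hv1, fun u => ?_, ?_⟩, ?_⟩, hle, v, hv, hv1, hvc⟩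
  · rw [Matrix.vecMulVec_mulVec, op_smul_eq_smul]
    exact Submodule.smul_mem _ _ hv
  · rw [expect_vecMulVec, hvc]
  · rintro r ⟨σ, ⟨hσ, htr⟩, hrange, rfl⟩
    obtain ⟨u, hu, hsum⟩ := posSemidef_eq_sum hσ
    have hn : ∑ k, normSq (u k) = 1 := by
      have := trace_of_eq_sum hsum
      rw [htr] at this
      exact_mod_cast this.symm
    rw [expect, re_trace_mul_of_eq_sum hsum, ← mul_one c, ← hn, Finset.mul_sum]
    refine Finset.sum_le_sum fun k _ => hle _ ?_
    obtain ⟨y, hy⟩ := hu k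
    rw [← hy]
    exact hrange y

theorem isGreatest_extensionBound (m : ℕ) :
    IsGreatest (extensionValues S w m) (extensionBound S w m) := by
  obtain ⟨c, hc, -⟩ := exists_isGreatest_extensionValues S w m
  rwa [extensionBound, hc.csSup_eq]

variable {S} in
theorem quadForm_le_extensionBound {m : ℕ} {v : (Fin (m + 2) → Bits ℓ) → ℂ}
    (hv : v ∈ symSubspace (Bits ℓ) (m + 2)) :
    quadForm (extendOp m (pairHamiltonian S w)) v ≤ extensionBound S w m * normSq v := by
  obtain ⟨c, hc, h, -⟩ := exists_isGreatest_extensionValues S w m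
  rw [extensionBound, hc.csSup_eq]
  exact h v hv

theorem exists_quadForm_eq_extensionBound (m : ℕ) :
    ∃ v ∈ symSubspace (Bits ℓ) (m + 2), normSq v = 1 ∧
      quadForm (extendOp m (pairHamiltonian S w)) v = extensionBound S w m := by
  obtain ⟨c, hc, -, h⟩ := exists_isGreatest_extensionValues S w m
  rwa [extensionBound, hc.csSup_eq]

/-- The matrix whose columns are the vectors `dickeVector s`. -/
noncomputable def dickeMatrix (ℓ m : ℕ) : Matrix (Fin (m + 2) → Bits ℓ) (Sym (Bits ℓ) (m + 2)) ℂ :=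
  fun x s => dickeVector s x

theorem dickeMatrix_mulVec {m : ℕ} (g : Sym (Bits ℓ) (m + 2) → ℂ) :
    (dickeMatrix ℓ m).mulVec g = ∑ s, g s • dickeVector s := by
  funext x
  simp [Matrix.mulVec, dotProduct, dickeMatrix, Finset.sum_apply, mul_comm]

theorem gramMatrix_eq (m : ℕ) :
    gramMatrix ℓ m = (dickeMatrix ℓ m).conjTranspose * dickeMatrix ℓ m := by
  ext s t
  rfl

theorem reducedMatrix_eq (m : ℕ) :
    reducedMatrix S w m = (dickeMatrix ℓ m).conjTranspose *
      (extendOp m (pairHamiltonian S w) * dickeMatrix ℓ m) := by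
  ext s t
  rfl

theorem dotProduct_gramMatrix {m : ℕ} (g : Sym (Bits ℓ) (m + 2) → ℂ) :
    star g ⬝ᵥ (gramMatrix ℓ m).mulVec g = (normSq (∑ s, g s • dickeVector s) : ℂ) := by
  rw [gramMatrix_eq, ← dickeMatrix_mulVec, ← star_dotProduct_self, Matrix.star_mulVec,
    ← Matrix.mulVec_mulVec, Matrix.dotProduct_mulVec (star g)]

theorem quadForm_reducedMatrix {m : ℕ} (g : Sym (Bits ℓ) (m + 2) → ℂ) :
    quadForm (reducedMatrix S w m) g =
      quadForm (extendOp m (pairHamiltonian S w)) (∑ s, g s • dickeVector s) := by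
  rw [quadForm, quadForm, reducedMatrix_eq, ← dickeMatrix_mulVec, Matrix.star_mulVec,
    ← Matrix.mulVec_mulVec, ← Matrix.mulVec_mulVec, Matrix.dotProduct_mulVec (star g)]

/-- A coefficient vector g corresponds to ∑ g_s v_s, under which the Gram matrix becomes the norm
and the reduced matrix the original form. Decomposing X into rank-one terms reduces both directions
to vectors; the v_s need not be normalized. -/
theorem isGreatest_reducedValues (m : ℕ) :
    IsGreatest (reducedValues S w m) (extensionBound S w m) := by
  constructor
  · obtain ⟨v, hv, hv1, hvc⟩ := exists_quadForm_eq_extensionBound S w m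
    obtain ⟨g, rfl⟩ := exists_sum_smul_dickeVector hv
    refine ⟨Matrix.vecMulVec g (star g), Matrix.posSemidef_vecMulVec_self_star g, ?_, ?_⟩
    · rw [trace_vecMulVec_mul, dotProduct_gramMatrix, hv1, Complex.ofReal_one]
    · rw [trace_vecMulVec_mul, ← hvc, ← quadForm_reducedMatrix]; rfl
  · rintro r ⟨X, hX, htr, rfl⟩
    obtain ⟨u, -, hsum⟩ := posSemidef_eq_sum hX
    have hn : ∑ k, normSq (∑ s, u k s • dickeVector (ι := Bits ℓ) s) = 1 := by
      rw [trace_mul_of_eq_sum hsum] at htr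
      simp only [dotProduct_gramMatrix] at htr
      exact_mod_cast htr
    rw [re_trace_mul_of_eq_sum hsum, ← mul_one (extensionBound S w m), ← hn, Finset.mul_sum]
    refine Finset.sum_le_sum fun k _ => ?_
    rw [quadForm_reducedMatrix]
    exact quadForm_le_extensionBound w
      (Submodule.sum_mem _ fun s _ => Submodule.smul_mem _ _ (dickeVector_mem_symSubspace s))

theorem quadForm_extendOp_succ {ι : Type} [Fintype ι] [DecidableEq ι] (m : ℕ)
    (H : Matrix (ι × ι) (ι × ι) ℂ) (v : (Fin (m + 3) → ι) → ℂ) :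
    quadForm (extendOp (m + 1) H) v =
      ∑ a, quadForm (extendOp m H) fun x => v (Fin.snoc x a : Fin (m + 3) → ι) := by
  simp only [quadForm, ← Complex.re_sum]
  congr 1
  simp only [dotProduct_extendOp]
  rw [sum_eq_sum_snoc]
  simp only [Fin.cons_snoc_eq_snoc_cons]

theorem normSq_eq_sum_snoc {ι : Type} [Fintype ι] {N : ℕ} (v : (Fin (N + 1) → ι) → ℂ) :
    normSq v = ∑ a, normSq fun x => v (Fin.snoc x a : Fin (N + 1) → ι) := by
  simp only [normSq]
  rw [sum_eq_sum_snoc]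

/-- The vector form of tracing out the last copy: the slices of an optimal vector lie in the
symmetric subspace one level below, and both the form and the squared norm are sums over slices. -/
theorem antitone_extensionBound : Antitone (extensionBound S w) := by
  refine antitone_nat_of_succ_le fun m => ?_
  obtain ⟨v, hv, hv1, hvc⟩ := exists_quadForm_eq_extensionBound S w (m + 1)
  rw [← hvc, ← mul_one (extensionBound S w m), ← hv1, normSq_eq_sum_snoc, Finset.mul_sum,
    quadForm_extendOp_succ]
  exact Finset.sum_le_sum fun a _ => quadForm_le_extensionBound w (slice_last_mem_symSubspace hv a)

variable {w} in
-- Each `S i ⊗ S i ⊗ 1` is a Hermitian involution, so it contributes at most `w i`.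
theorem extensionBound_le_sum (hw : ∀ i, 0 ≤ w i) (m : ℕ) : extensionBound S w m ≤ ∑ i, w i := by
  obtain ⟨v, hv, hv1, hvc⟩ := exists_quadForm_eq_extensionBound S w m
  rw [← hvc, quadForm_extendOp_pairHamiltonian]
  refine Finset.sum_le_sum fun i _ => mul_le_of_le_one_right (hw i) ?_
  rw [← hv1]
  apply quadForm_le_normSq
  · apply extendOp_isHermitian
    rw [Matrix.IsHermitian, Matrix.conjTranspose_kronecker, (S i).mat_isHermitian.eq]
  · apply extendOp_mul_self
    rw [← Matrix.mul_kronecker_mul, (S i).mat_mul_self, Matrix.one_kronecker_one]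

end Programs

/-! ### The beta number and product vectors -/

section BetaNumber

theorem normSq_tensorPower {ι : Type} [Fintype ι] (N : ℕ) (ψ : ι → ℂ) :
    normSq (fun x : Fin N → ι => ∏ k, ψ (x k)) = normSq ψ ^ N := by
  classical
  simp only [normSq, map_prod]
  rw [← Fintype.prod_sum fun (_ : Fin N) a => Complex.normSq (ψ a)]
  simp

theorem quadForm_extendOp_tensorPower {ι : Type} [Fintype ι] [DecidableEq ι] (m : ℕ)
    {A : Matrix ι ι ℂ} (hA : A.IsHermitian) (ψ : ι → ℂ) :
    quadForm (extendOp m (A ⊗ₖ A)) (fun x : Fin (m + 2) → ι => ∏ k, ψ (x k)) =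
      quadForm A ψ ^ 2 * normSq ψ ^ m := by
  rw [← normSq_tensorPower, quadForm, dotProduct_extendOp]
  have h : (quadForm A ψ : ℂ) = ∑ a, ∑ c, star (ψ a) * A a c * ψ c := by
    rw [ofReal_quadForm hA]
    simp only [dotProduct, Matrix.mulVec, Finset.mul_sum, Pi.star_apply, mul_assoc]
  have h2 : ∀ r : Fin m → ι, (∑ p : ι × ι, ∑ q : ι × ι,
      star (∏ k, ψ ((Fin.cons p.1 (Fin.cons p.2 r : Fin (m + 1) → ι) : Fin (m + 2) → ι) k)) *
        (A ⊗ₖ A) p q *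
        ∏ k, ψ ((Fin.cons q.1 (Fin.cons q.2 r : Fin (m + 1) → ι) : Fin (m + 2) → ι) k)) =
      ((quadForm A ψ ^ 2 * Complex.normSq (∏ k, ψ (r k)) : ℝ) : ℂ) := by
    intro r
    push_cast
    rw [h, sq, Finset.sum_mul_sum, Finset.sum_mul, Fintype.sum_prod_type]
    refine Finset.sum_congr rfl fun a _ => ?_
    rw [Finset.sum_mul]
    refine Finset.sum_congr rfl fun b _ => ?_
    rw [Finset.sum_mul_sum, Finset.sum_mul, Fintype.sum_prod_type]
    refine Finset.sum_congr rfl fun c _ => ?_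
    rw [Finset.sum_mul]
    refine Finset.sum_congr rfl fun e _ => ?_
    rw [← Complex.mul_conj]
    simp only [Fin.prod_univ_succ, Fin.cons_zero, Fin.cons_succ, Matrix.kroneckerMap_apply,
      star_mul', RCLike.star_def]
    ring
  simp only [h2, ← Complex.ofReal_sum, Complex.ofReal_re, ← Finset.mul_sum]
  rfl

variable {n ℓ : ℕ} (S : Fin n → PauliString ℓ) {w : Fin n → ℝ}

/-- Tests the program with ψ^{⊗(m+2)}; the m idle copies contribute |ψ|^{2m}, which cancels. -/
theorem sum_mul_quadForm_sq_le (m : ℕ) (w : Fin n → ℝ) (ψ : Bits ℓ → ℂ) :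
    ∑ i, w i * quadForm (S i).mat ψ ^ 2 ≤ extensionBound S w m * normSq ψ ^ 2 := by
  rcases eq_or_ne ψ 0 with rfl | hψ
  · simp [quadForm, normSq]
  have hpos : 0 < normSq ψ := (normSq_nonneg ψ).lt_of_ne fun h => hψ (normSq_eq_zero.1 h.symm)
  have h := quadForm_le_extensionBound (S := S) w (m := m)
    (v := fun x => ∏ k, ψ (x k)) (Submodule.subset_span ⟨ψ, rfl⟩)
  rw [quadForm_extendOp_pairHamiltonian, normSq_tensorPower] at h
  simp only [quadForm_extendOp_tensorPower m (S _).mat_isHermitian, ← mul_assoc] at h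
  rw [← Finset.sum_mul, add_comm m 2, pow_add, ← mul_assoc] at h
  exact le_of_mul_le_mul_right h (pow_pos hpos m)

/-- The objective of the beta number is convex, so that it is bounded by its values at pure
states. -/
theorem sum_mul_expect_sq_le (hw : ∀ i, 0 ≤ w i) {b : ℝ}
    (hb : ∀ ψ : Bits ℓ → ℂ, ∑ i, w i * quadForm (S i).mat ψ ^ 2 ≤ b * normSq ψ ^ 2)
    {ρ : Matrix (Bits ℓ) (Bits ℓ) ℂ} (hρ : IsState ρ) :
    ∑ i, w i * expect ρ (S i).mat ^ 2 ≤ b := by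
  obtain ⟨u, -, hsum⟩ := posSemidef_eq_sum hρ.1
  have hn : ∑ k, normSq (u k) = 1 := by
    have := trace_of_eq_sum hsum
    rw [hρ.2] at this
    exact_mod_cast this.symm
  have hcs : ∀ i, expect ρ (S i).mat ^ 2 ≤ ∑ k, quadForm (S i).mat (u k) ^ 2 / normSq (u k) := by
    intro i
    rw [expect, re_trace_mul_of_eq_sum hsum, ← one_mul (∑ k, _ / _), ← hn]
    -- Cauchy-Schwarz with the weights |u_k|², which sum to one. Where u_k = 0 the quotient is 0 by
    -- convention and the form vanishes as well.
    refine Finset.sum_sq_le_sum_mul_sum_of_sq_le_mul _ (fun k _ => normSq_nonneg _)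
      (fun k _ => div_nonneg (sq_nonneg _) (normSq_nonneg _)) fun k _ => ?_
    rcases eq_or_ne (normSq (u k)) 0 with h | h
    · simp [normSq_eq_zero.1 h, quadForm]
    · exact le_of_eq (by field_simp)
  calc ∑ i, w i * expect ρ (S i).mat ^ 2
      ≤ ∑ i, w i * ∑ k, quadForm (S i).mat (u k) ^ 2 / normSq (u k) :=
        Finset.sum_le_sum fun i _ => mul_le_mul_of_nonneg_left (hcs i) (hw i)
    _ = ∑ k, (∑ i, w i * quadForm (S i).mat (u k) ^ 2) / normSq (u k) := by
        simp only [Finset.mul_sum, Finset.sum_div, mul_div_assoc]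
        exact Finset.sum_comm
    _ ≤ ∑ k, b * normSq (u k) := by
        refine Finset.sum_le_sum fun k _ => ?_
        rcases (normSq_nonneg (u k)).eq_or_lt with h | h
        · simp [← h]
        · rw [div_le_iff₀ h, mul_assoc, ← sq]
          exact hb (u k)
    _ = b := by rw [← Finset.mul_sum, hn, mul_one]

theorem betaNumber_le_extensionBound (hw : ∀ i, 0 ≤ w i) (m : ℕ) :
    betaNumber S w ≤ extensionBound S w m := by
  have hb := sum_mul_quadForm_sq_le S m w
  apply csSup_le
  · obtain ⟨c, hc⟩ := exists_unit_multiple (v := (1 : Bits ℓ → ℂ)) one_ne_zero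
    exact ⟨_, _, isState_vecMulVec (by rwa [normSq_smul]), rfl⟩
  · rintro r ⟨ρ, hρ, rfl⟩
    exact sum_mul_expect_sq_le S hw hb hρ

theorem le_betaNumber (hw : ∀ i, 0 ≤ w i) {ρ : Matrix (Bits ℓ) (Bits ℓ) ℂ} (hρ : IsState ρ) :
    ∑ i, w i * expect ρ (S i).mat ^ 2 ≤ betaNumber S w := by
  -- Boundedness has to be supplied for the supremum; c^(0) serves as a bound.
  refine le_csSup ⟨extensionBound S w 0, ?_⟩ ⟨ρ, hρ, rfl⟩
  rintro r ⟨ρ, hρ, rfl⟩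
  exact sum_mul_expect_sq_le S hw (sum_mul_quadForm_sq_le S 0 w) hρ

theorem betaNumber_nonneg (hw : ∀ i, 0 ≤ w i) : 0 ≤ betaNumber S w := by
  obtain ⟨c, hc⟩ := exists_unit_multiple (v := (1 : Bits ℓ → ℂ)) one_ne_zero
  exact le_trans (Finset.sum_nonneg fun i _ => mul_nonneg (hw i) (sq_nonneg _))
    (le_betaNumber S hw (isState_vecMulVec (by rwa [normSq_smul])))

theorem sum_mul_quadForm_sq_le_betaNumber (hw : ∀ i, 0 ≤ w i) (ψ : Bits ℓ → ℂ) :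
    ∑ i, w i * quadForm (S i).mat ψ ^ 2 ≤ betaNumber S w * normSq ψ ^ 2 := by
  rcases eq_or_ne ψ 0 with rfl | hψ
  · simp [quadForm, normSq]
  obtain ⟨c, hc⟩ := exists_unit_multiple hψ
  have h := le_betaNumber S hw (isState_vecMulVec (v := c • ψ) (by rwa [normSq_smul]))
  simp only [expect_vecMulVec, quadForm_smul] at h
  have h2 := mul_le_mul_of_nonneg_right h (sq_nonneg (normSq ψ))
  refine le_trans (le_of_eq ?_) h2
  rw [Finset.sum_mul]
  refine Finset.sum_congr rfl fun i _ => ?_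
  calc w i * quadForm (S i).mat ψ ^ 2
      = w i * quadForm (S i).mat ψ ^ 2 * (Complex.normSq c * normSq ψ) ^ 2 := by rw [hc]; ring
    _ = _ := by ring

end BetaNumber

/-! ### Moments of the complex Gaussian -/

section Gaussian

open MeasureTheory

/-- The density of the standard complex Gaussian measure. -/
noncomputable def gaussDensity (z : ℂ) : ℝ := Real.exp (-‖z‖ ^ 2) / Real.pi

theorem gaussDensity_nonneg (z : ℂ) : 0 ≤ gaussDensity z :=
  div_nonneg (Real.exp_pos _).le Real.pi_pos.le

theorem integral_norm_pow_mul_gaussDensity (k : ℕ) :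
    ∫ z : ℂ, ‖z‖ ^ k * gaussDensity z = Real.Gamma ((k + 2) / 2) := by
  have h := Complex.integral_rpow_mul_exp_neg_rpow (p := 2) (q := k) one_le_two
    (by have := k.cast_nonneg (α := ℝ); linarith)
  simp only [gaussDensity, ← mul_div_assoc, integral_div]
  have h2 : (fun z : ℂ => ‖z‖ ^ k * Real.exp (-‖z‖ ^ 2)) =
      fun z : ℂ => ‖z‖ ^ (k : ℝ) * Real.exp (-‖z‖ ^ (2 : ℝ)) := by
    funext z
    rw [Real.rpow_natCast, Real.rpow_two]
  rw [h2, h]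
  have := Real.pi_pos
  field_simp

/-- The integral of a non-integrable function is 0 by convention, whereas this one is a positive
value of the Gamma function. -/
theorem integrable_norm_pow_mul_gaussDensity (k : ℕ) :
    Integrable fun z : ℂ => ‖z‖ ^ k * gaussDensity z := by
  by_contra h
  have h1 := integral_norm_pow_mul_gaussDensity k
  rw [integral_undef h] at h1
  have : (0 : ℝ) < (k + 2) / 2 := by positivity
  exact (Real.Gamma_pos_of_pos this).ne h1

theorem integrable_moment (a b : ℕ) :
    Integrable fun z : ℂ => (gaussDensity z : ℂ) * (z ^ a * star z ^ b) := by
  refine (integrable_norm_pow_mul_gaussDensity (a + b)).mono' ?_ (ae_of_all _ fun z => ?_)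
  · refine Continuous.aestronglyMeasurable ?_
    unfold gaussDensity
    fun_prop
  · rw [norm_mul, norm_mul, norm_pow, norm_pow, norm_star, ← pow_add, Complex.norm_real,
      Real.norm_of_nonneg (gaussDensity_nonneg z), mul_comm]

theorem integral_moment (a b : ℕ) :
    ∫ z : ℂ, (gaussDensity z : ℂ) * (z ^ a * star z ^ b) =
      if a = b then (a.factorial : ℂ) else 0 := by
  split_ifs with hab
  · subst hab
    have h : (fun z : ℂ => (gaussDensity z : ℂ) * (z ^ a * star z ^ a)) =
        fun z => ((‖z‖ ^ (2 * a) * gaussDensity z : ℝ) : ℂ) := by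
      funext z
      rw [← mul_pow, RCLike.star_def, Complex.mul_conj, Complex.normSq_eq_norm_sq]
      push_cast
      ring
    rw [h, integral_complex_ofReal, integral_norm_pow_mul_gaussDensity]
    have h2 : ((2 * a : ℕ) + 2 : ℝ) / 2 = a + 1 := by push_cast; ring
    rw [h2, Real.Gamma_nat_eq_factorial]
    simp
  -- Rotation by the angle π/(a-b) preserves the measure and multiplies the integrand by u^a ū^b =
  -- -1, so the integral equals its own negative.
  · set u : Circle := Circle.exp (Real.pi / ((a : ℝ) - b)) with hu
    have hne : (a : ℝ) - b ≠ 0 := sub_ne_zero.2 (by exact_mod_cast hab)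
    have hphase : (u : ℂ) ^ a * star (u : ℂ) ^ b = -1 := by
      rw [hu, Circle.coe_exp, RCLike.star_def, ← Complex.exp_conj, ← Complex.exp_nat_mul,
        ← Complex.exp_nat_mul, ← Complex.exp_add, ← Complex.exp_pi_mul_I]
      congr 1
      have hne' : (a : ℂ) - b ≠ 0 := by exact_mod_cast hne
      simp only [map_mul, map_div₀, map_sub, Complex.conj_ofReal, Complex.conj_I, map_natCast,
        Complex.ofReal_div, Complex.ofReal_sub, Complex.ofReal_natCast]
      field_simp
      ring
    have h := (rotation u).measurePreserving.integral_comp'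
      (f := (rotation u).toHomeomorph.toMeasurableEquiv)
      (fun z : ℂ => (gaussDensity z : ℂ) * (z ^ a * star z ^ b))
    have h2 : (fun z : ℂ => (gaussDensity (rotation u z) : ℂ) *
        ((rotation u z) ^ a * star (rotation u z) ^ b)) =
        fun z => -((gaussDensity z : ℂ) * (z ^ a * star z ^ b)) := by
      funext z
      have h3 : gaussDensity (rotation u z) = gaussDensity z := by
        rw [gaussDensity, LinearIsometryEquiv.norm_map, gaussDensity]
      rw [h3, rotation_apply, star_mul', mul_pow, mul_pow, mul_mul_mul_comm ((u : ℂ) ^ a), hphase]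
      ring
    change ∫ z : ℂ, (gaussDensity (rotation u z) : ℂ) *
        ((rotation u z) ^ a * star (rotation u z) ^ b) = _ at h
    rw [h2, integral_neg] at h
    exact CharZero.neg_eq_self_iff.1 h

end Gaussian

/-! ### The Bargmann-Fock inner product -/

section Fock

open MeasureTheory MvPolynomial

variable {ι : Type} [Fintype ι]

/-- The integrand of the Bargmann-Fock inner product. -/
noncomputable def fockIntegrand (f g : MvPolynomial ι ℂ) (z : ι → ℂ) : ℂ :=
  ((∏ i, gaussDensity (z i) : ℝ) : ℂ) * (eval z f * star (eval z g))

/-- The Bargmann-Fock inner product of polynomials. -/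
noncomputable def fock (f g : MvPolynomial ι ℂ) : ℂ := ∫ z, fockIntegrand f g z

theorem fockIntegrand_monomial (α β : ι →₀ ℕ) (a b : ℂ) (z : ι → ℂ) :
    fockIntegrand (monomial α a) (monomial β b) z =
      a * star b * ∏ i, (gaussDensity (z i) : ℂ) * (z i ^ α i * star (z i) ^ β i) := by
  simp only [fockIntegrand, eval_monomial, Finsupp.prod_fintype _ _ (fun i => pow_zero _),
    star_mul', star_prod, star_pow, Finset.prod_mul_distrib, Complex.ofReal_prod]
  ring

theorem fockIntegrand_add_left (f f' g : MvPolynomial ι ℂ) :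
    fockIntegrand (f + f') g = fockIntegrand f g + fockIntegrand f' g := by
  funext z; simp only [fockIntegrand, map_add, Pi.add_apply]; ring

theorem fockIntegrand_add_right (f g g' : MvPolynomial ι ℂ) :
    fockIntegrand f (g + g') = fockIntegrand f g + fockIntegrand f g' := by
  funext z; simp only [fockIntegrand, map_add, Pi.add_apply, star_add]; ring

theorem integrable_fockIntegrand (f g : MvPolynomial ι ℂ) : Integrable (fockIntegrand f g) := by
  induction f using MvPolynomial.induction_on' with
  | add f f' hf hf' => rw [fockIntegrand_add_left]; exact hf.add hf'
  | monomial α a =>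
    induction g using MvPolynomial.induction_on' with
    | add g g' hg hg' => rw [fockIntegrand_add_right]; exact hg.add hg'
    | monomial β b =>
      have : fockIntegrand (monomial α a) (monomial β b) = fun z =>
          a * star b * ∏ i, (gaussDensity (z i) : ℂ) * (z i ^ α i * star (z i) ^ β i) :=
        funext fun z => fockIntegrand_monomial α β a b z
      rw [this]
      exact (Integrable.fintype_prod fun i => integrable_moment (α i) (β i)).const_mul _

theorem fock_add_left (f f' g : MvPolynomial ι ℂ) : fock (f + f') g = fock f g + fock f' g := by
  rw [fock, fockIntegrand_add_left]
  exact integral_add (integrable_fockIntegrand f g) (integrable_fockIntegrand f' g)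

theorem fock_add_right (f g g' : MvPolynomial ι ℂ) : fock f (g + g') = fock f g + fock f g' := by
  rw [fock, fockIntegrand_add_right]
  exact integral_add (integrable_fockIntegrand f g) (integrable_fockIntegrand f g')

theorem fock_C_mul_left (c : ℂ) (f g : MvPolynomial ι ℂ) : fock (C c * f) g = c * fock f g := by
  rw [fock, fock, ← integral_const_mul]
  congr 1
  funext z
  simp only [fockIntegrand, map_mul, eval_C]
  ring

theorem fock_zero_left (g : MvPolynomial ι ℂ) : fock 0 g = 0 := by
  simp [fock, fockIntegrand]

theorem star_fock (f g : MvPolynomial ι ℂ) : star (fock f g) = fock g f := by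
  rw [fock, fock, RCLike.star_def, ← integral_conj]
  congr 1
  funext z
  simp only [fockIntegrand, map_mul, RCLike.star_def, Complex.conj_conj, Complex.conj_ofReal]
  ring

theorem fock_C_mul_right (c : ℂ) (f g : MvPolynomial ι ℂ) :
    fock f (C c * g) = star c * fock f g := by
  rw [← star_fock, fock_C_mul_left, star_mul', star_fock]

theorem fock_sum_left {κ : Type*} (s : Finset κ) (f : κ → MvPolynomial ι ℂ)
    (g : MvPolynomial ι ℂ) : fock (∑ k ∈ s, f k) g = ∑ k ∈ s, fock (f k) g := by
  classical
  induction s using Finset.induction_on with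
  | empty => simp [fock_zero_left]
  | insert k s hk ih => rw [Finset.sum_insert hk, Finset.sum_insert hk, fock_add_left, ih]

/-- The Gaussian measure is a product, so the inner product factors into one-variable moments:
monomials are orthogonal, with squared norm α!. -/
theorem fock_monomial (α β : ι →₀ ℕ) (a b : ℂ) :
    fock (monomial α a) (monomial β b) =
      if α = β then a * star b * ∏ i, ((α i).factorial : ℂ) else 0 := by
  simp only [fock, fockIntegrand_monomial]
  rw [integral_const_mul, integral_fintype_prod_volume_eq_prod
    fun i (z : ℂ) => (gaussDensity z : ℂ) * (z ^ α i * star z ^ β i)]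
  simp only [integral_moment]
  split_ifs with h
  · subst h; simp
  · obtain ⟨i, hi⟩ := DFunLike.ne_iff.1 h
    rw [Finset.prod_eq_zero (Finset.mem_univ i) (if_neg hi), mul_zero]

/-- Multiplication by a variable is adjoint to the derivative. -/
theorem fock_X_mul_left (i : ι) (f g : MvPolynomial ι ℂ) :
    fock (X i * f) g = fock f (pderiv i g) := by
  classical
  induction f using MvPolynomial.induction_on' with
  | add f f' hf hf' => rw [mul_add, fock_add_left, fock_add_left, hf, hf']
  | monomial α a =>
    induction g using MvPolynomial.induction_on' with
    | add g g' hg hg' => rw [map_add, fock_add_right, fock_add_right, hg, hg']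
    | monomial β b =>
      rw [pderiv_monomial, X, monomial_mul, one_mul, fock_monomial, fock_monomial]
      by_cases h : Finsupp.single i 1 + α = β
      · subst h
        rw [if_pos rfl, if_pos (by simp), ← Finset.mul_prod_erase _ _ (Finset.mem_univ i),
          ← Finset.mul_prod_erase _ (fun j => ((α j).factorial : ℂ)) (Finset.mem_univ i),
          Finset.prod_congr rfl (g := fun j => ((α j).factorial : ℂ))]
        · simp only [Finsupp.add_apply, Finsupp.single_eq_same, add_comm 1, Nat.factorial_succ]
          simp only [star_mul', star_natCast]
          push_cast
          ring
        · intro j hj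
          simp [(Finset.ne_of_mem_erase hj).symm]
      · rw [if_neg h]
        -- Truncated subtraction makes β minus the i-th unit equal to β when β i = 0, so the
        -- exponents may agree spuriously; the derivative then has coefficient zero.
        by_cases hβ : β i = 0
        · simp [hβ]
        · rw [if_neg]
          rintro rfl
          apply h
          ext j
          by_cases hj : i = j
          · subst hj
            simp
            omega
          · simp [hj]

theorem fock_X_mul_right (i : ι) (f g : MvPolynomial ι ℂ) :
    fock f (X i * g) = fock (pderiv i f) g := by
  rw [← star_fock, fock_X_mul_left, star_fock]

end Fock

/-! ### Symmetric tensors as homogeneous polynomials -/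

section SymmetricPolynomials

open MvPolynomial

variable {ι : Type} [Fintype ι]

/-- The homogeneous polynomial with the coefficient tensor `v`. -/
noncomputable def symPoly {N : ℕ} (v : (Fin N → ι) → ℂ) : MvPolynomial ι ℂ :=
  ∑ x, C (v x) * ∏ k, X (x k)

theorem symPoly_succ {N : ℕ} (v : (Fin (N + 1) → ι) → ℂ) :
    symPoly v = ∑ a, X a * symPoly fun x : Fin N → ι => v (Fin.cons a x : Fin (N + 1) → ι) := by
  simp only [symPoly]
  rw [sum_eq_sum_cons]
  refine Finset.sum_congr rfl fun a _ => ?_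
  rw [Finset.mul_sum]
  refine Finset.sum_congr rfl fun x _ => ?_
  simp only [Fin.prod_univ_succ, Fin.cons_zero, Fin.cons_succ]
  ring

variable [DecidableEq ι]

/-- Split off one variable, f = ∑ X_b f_b. The product rule gives f_a once from ∂X_a and, by
induction and symmetry of the first two indices, N more times from the derivatives of the f_b. -/
theorem pderiv_symPoly {N : ℕ} {v : (Fin (N + 1) → ι) → ℂ} (hv : v ∈ symSubspace ι (N + 1))
    (a : ι) : pderiv a (symPoly v) =
      C (N + 1 : ℂ) * symPoly fun x : Fin N → ι => v (Fin.cons a x : Fin (N + 1) → ι) := by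
  rw [symPoly_succ, map_sum]
  simp only [pderiv_mul, pderiv_X, Finset.sum_add_distrib]
  have h1 : ∑ b, (Pi.single a (1 : MvPolynomial ι ℂ) : ι → MvPolynomial ι ℂ) b *
      symPoly (fun x : Fin N → ι => v (Fin.cons b x : Fin (N + 1) → ι)) =
      symPoly fun x : Fin N → ι => v (Fin.cons a x : Fin (N + 1) → ι) := by
    rw [Finset.sum_eq_single a]
    · simp
    · intro b _ hb; simp [hb]
    · simp
  rw [h1]
  cases N with
  | zero =>
    have h2 : ∀ b, pderiv a (symPoly fun x : Fin 0 → ι => v (Fin.cons b x : Fin 1 → ι)) = 0 := by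
      intro b; simp [symPoly]
    simp [h2]
  | succ N =>
    have h2 : ∑ b, X b * pderiv a (symPoly fun x : Fin (N + 1) → ι =>
        v (Fin.cons b x : Fin (N + 2) → ι)) = C (N + 1 : ℂ) *
        symPoly fun x : Fin (N + 1) → ι => v (Fin.cons a x : Fin (N + 2) → ι) := by
      rw [symPoly_succ fun x : Fin (N + 1) → ι => v (Fin.cons a x : Fin (N + 2) → ι),
        Finset.mul_sum]
      refine Finset.sum_congr rfl fun b _ => ?_
      rw [pderiv_symPoly (slice_mem_symSubspace hv b) a]
      simp only [cons_cons_comm_of_mem_symSubspace hv b a]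
      ring
    rw [h2]
    simp only [C_add, C_1, Nat.cast_add, Nat.cast_one]
    ring

/-- Euler's identity: ∑ X_a ∂_a is the number operator. -/
theorem sum_X_mul_pderiv_symPoly {N : ℕ} {v : (Fin N → ι) → ℂ} (hv : v ∈ symSubspace ι N) :
    ∑ a, X a * pderiv a (symPoly v) = C (N : ℂ) * symPoly v := by
  cases N with
  | zero => simp [symPoly]
  | succ N =>
    rw [symPoly_succ v, Finset.mul_sum, ← symPoly_succ v]
    refine Finset.sum_congr rfl fun a _ => ?_
    rw [pderiv_symPoly hv]
    push_cast
    ring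

/-- Adjointness moves one variable at a time to the other side as a derivative; the factors N + 1,
N, … accumulate to the factorial. -/
theorem fock_symPoly {N : ℕ} (v : (Fin N → ι) → ℂ) {u : (Fin N → ι) → ℂ}
    (hu : u ∈ symSubspace ι N) :
    fock (symPoly v) (symPoly u) = N.factorial * ∑ x, v x * star (u x) := by
  induction N with
  | zero =>
    have h := fock_monomial (0 : ι →₀ ℕ) 0 (v default) (u default)
    simp only [symPoly, Fintype.sum_unique, Finset.univ_eq_empty, Finset.prod_empty, mul_one]
    simpa using h
  | succ N ih =>
    rw [symPoly_succ v, fock_sum_left, sum_eq_sum_cons, Finset.mul_sum]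
    refine Finset.sum_congr rfl fun a _ => ?_
    rw [fock_X_mul_left, pderiv_symPoly hu, fock_C_mul_right, ih _ (slice_mem_symSubspace hu a),
      Nat.factorial_succ]
    simp only [star_add, star_natCast, star_one]
    push_cast
    ring

end SymmetricPolynomials

/-! ### Anti-normal ordering and the commutation relations -/

section AntiWick

open MvPolynomial

variable {ι : Type} [Fintype ι] (A : Matrix ι ι ℂ)

/-- The linear form given by a column of `A`. -/
noncomputable def columnForm (a : ι) : MvPolynomial ι ℂ := ∑ c, C (A c a) * X c

/-- The quadratic form of the anti-normally ordered second quantization of `A ⊗ A`. -/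
noncomputable def antiWick (f : MvPolynomial ι ℂ) : ℂ :=
  ∑ a, ∑ b, fock (columnForm A a * (columnForm A b * f)) (X a * (X b * f))

theorem fock_columnForm_mul (a : ι) (f g : MvPolynomial ι ℂ) :
    fock (columnForm A a * f) g = ∑ c, A c a * fock f (pderiv c g) := by
  rw [columnForm, Finset.sum_mul, fock_sum_left]
  refine Finset.sum_congr rfl fun c _ => ?_
  rw [mul_assoc, fock_C_mul_left, fock_X_mul_left]

variable [DecidableEq ι]

theorem pderiv_columnForm (a b : ι) : pderiv b (columnForm A a) = C (A b a) := by
  rw [columnForm, map_sum, Finset.sum_eq_single b]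
  · simp
  · intro c _ hc
    rw [pderiv_C_mul, pderiv_X_of_ne hc, mul_zero]
  · simp

variable {A}

/-- Because of this, the two mixed contraction terms of the commutation, second quantizations of A²,
both become the number operator. -/
theorem sum_mul_columnForm (hA : A * A = 1) (b : ι) :
    ∑ a, C (A a b) * columnForm A a = X b := by
  simp only [columnForm, Finset.mul_sum]
  rw [Finset.sum_comm]
  have h : ∀ c, ∑ a, C (A a b) * (C (A c a) * X c : MvPolynomial ι ℂ) =
      C ((1 : Matrix ι ι ℂ) c b) * X c := by
    intro c
    rw [← hA, Matrix.mul_apply, map_sum, Finset.sum_mul]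
    refine Finset.sum_congr rfl fun a _ => ?_
    rw [C_mul]; ring
  simp only [h]
  rw [Finset.sum_eq_single b]
  · simp
  · intro c _ hc; simp [Matrix.one_apply_ne hc]
  · simp

/-- Commuting the derivatives past the multiplications. -/
theorem sum_pderiv_columnForm (hA : A * A = 1) (f : MvPolynomial ι ℂ) {N t : ℂ}
    (hN : ∑ a, X a * pderiv a f = C N * f)
    (ht : C A.trace * ∑ a, columnForm A a * pderiv a f = C t * f) :
    ∑ a, ∑ b, pderiv b (pderiv a (columnForm A a * (columnForm A b * f))) =
      C (A.trace ^ 2 + 2 * t + Fintype.card ι + 2 * N) * f +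
        ∑ a, ∑ b, columnForm A a * (columnForm A b * pderiv b (pderiv a f)) := by
  -- The seven terms of the product rule: no contraction survives in the last; the others sum to (tr
  -- A)², twice tr A · dΓ(A), tr A² = d, and twice dΓ(A²) = N.
  have h1 : ∀ a b, pderiv b (pderiv a (columnForm A a * (columnForm A b * f))) =
      C (A a a) * (C (A b b) * f) + C (A a a) * (columnForm A b * pderiv b f) +
      C (A a b * A b a) * f + C (A a b) * columnForm A a * pderiv b f +
      C (A b a) * columnForm A b * pderiv a f + C (A b b) * (columnForm A a * pderiv a f) +
      columnForm A a * (columnForm A b * pderiv b (pderiv a f)) := by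
    intro a b
    simp only [pderiv_mul, map_add, pderiv_columnForm, pderiv_C, C_mul]
    ring
  have htr : ∑ a, C (A a a) = (C A.trace : MvPolynomial ι ℂ) := by
    rw [← map_sum]; rfl
  have hcard : ∑ a, ∑ b, (C (A a b * A b a) * f) = C (Fintype.card ι : ℂ) * f := by
    have : ∑ a, ∑ b, A a b * A b a = (Fintype.card ι : ℂ) := by
      have h := congrArg Matrix.trace hA
      simpa [Matrix.trace, Matrix.mul_apply] using h
    rw [← this, map_sum, Finset.sum_mul]
    refine Finset.sum_congr rfl fun a _ => ?_
    rw [map_sum, Finset.sum_mul]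
  have hE : ∑ a, ∑ b, C (A b a) * columnForm A b * pderiv a f = C N * f := by
    rw [← hN]
    refine Finset.sum_congr rfl fun a _ => ?_
    rw [← sum_mul_columnForm hA a, Finset.sum_mul]
  have hE' : ∑ a, ∑ b, C (A a b) * columnForm A a * pderiv b f = C N * f := by
    rw [Finset.sum_comm, hE]
  have hT1 : ∑ a, ∑ b, C (A a a) * (C (A b b) * f) = C (A.trace ^ 2) * f := by
    simp only [← Finset.mul_sum, ← Finset.sum_mul, htr]
    rw [C_pow]; ring
  have hT2 : ∑ a, ∑ b, C (A a a) * (columnForm A b * pderiv b f) = C t * f := by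
    rw [← ht, ← htr, Finset.sum_mul]
    simp only [Finset.mul_sum]
  have hT3 : ∑ a, ∑ b, C (A b b) * (columnForm A a * pderiv a f) = C t * f := by
    rw [Finset.sum_comm, hT2]
  simp only [h1, Finset.sum_add_distrib]
  rw [hcard, hE, hE', hT1, hT2, hT3]
  simp only [C_add, C_mul, map_ofNat]
  ring

/-- Adjointness turns the two multiplications on the right into derivatives on the left. After
normal ordering, the term with both derivatives on f is the form of A ⊗ A ⊗ 1, with the factor
(m+2)(m+1) from differentiating twice; the rest is scalar. The hypothesis on `t` says that f is an
eigenvector of tr(A) dΓ(A). -/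
theorem antiWick_symPoly (hA : A * A = 1) {m : ℕ} {v : (Fin (m + 2) → ι) → ℂ}
    (hv : v ∈ symSubspace ι (m + 2)) {t : ℂ}
    (ht : C A.trace * ∑ a, columnForm A a * pderiv a (symPoly v) = C t * symPoly v) :
    antiWick A (symPoly v) = (m + 2).factorial *
      ((A.trace ^ 2 + 2 * t + Fintype.card ι + 2 * (m + 2)) * normSq v +
        (m + 2) * (m + 1) * (star v ⬝ᵥ (extendOp m (A ⊗ₖ A)).mulVec v)) := by
  have h1 : antiWick A (symPoly v) = fock (∑ a, ∑ b,
      pderiv b (pderiv a (columnForm A a * (columnForm A b * symPoly v)))) (symPoly v) := by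
    simp only [antiWick, fock_sum_left, fock_X_mul_right]
  rw [h1, sum_pderiv_columnForm hA _ (sum_X_mul_pderiv_symPoly hv) ht, fock_add_left,
    fock_C_mul_left, fock_symPoly v hv, dotProduct_extendOp]
  have h2 : ∑ x, v x * star (v x) = (normSq v : ℂ) := by
    rw [← star_dotProduct_self, dotProduct]
    exact Finset.sum_congr rfl fun x _ => mul_comm _ _
  have hd : ∀ a b, pderiv b (pderiv a (symPoly v)) = C ((m + 2) * (m + 1) : ℂ) *
      symPoly fun r : Fin m → ι =>
        v (Fin.cons a (Fin.cons b r : Fin (m + 1) → ι) : Fin (m + 2) → ι) := by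
    intro a b
    rw [pderiv_symPoly hv, pderiv_C_mul, pderiv_symPoly (slice_mem_symSubspace hv a), ← mul_assoc,
      ← C_mul]
    congr 2
    push_cast
    ring
  have h3 : ∀ a b, fock (columnForm A a * (columnForm A b * pderiv b (pderiv a (symPoly v))))
      (symPoly v) = ∑ c, ∑ e, A c a * A e b * ((m + 2) * (m + 1) * ((m + 2).factorial *
        ∑ r : Fin m → ι,
          v (Fin.cons a (Fin.cons b r : Fin (m + 1) → ι) : Fin (m + 2) → ι) *
          star (v (Fin.cons c (Fin.cons e r : Fin (m + 1) → ι) : Fin (m + 2) → ι)))) := by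
    intro a b
    rw [fock_columnForm_mul]
    refine Finset.sum_congr rfl fun c _ => ?_
    rw [fock_columnForm_mul, Finset.mul_sum]
    refine Finset.sum_congr rfl fun e _ => ?_
    rw [hd a b, hd c e, fock_C_mul_left, fock_C_mul_right,
      fock_symPoly _ (slice_mem_symSubspace (slice_mem_symSubspace hv c) e), Nat.factorial_succ,
      Nat.factorial_succ]
    simp only [star_mul', star_add, star_natCast, star_one, star_ofNat]
    push_cast
    ring
  have h4 : ∑ a, ∑ b, ∑ c, ∑ e, A c a * A e b * ((m + 2) * (m + 1) * ((m + 2).factorial *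
        ∑ r : Fin m → ι,
          v (Fin.cons a (Fin.cons b r : Fin (m + 1) → ι) : Fin (m + 2) → ι) *
          star (v (Fin.cons c (Fin.cons e r : Fin (m + 1) → ι) : Fin (m + 2) → ι)))) =
      (m + 2).factorial * ((m + 2) * (m + 1) * ∑ r : Fin m → ι, ∑ p : ι × ι, ∑ q : ι × ι,
        star (v (Fin.cons p.1 (Fin.cons p.2 r : Fin (m + 1) → ι) : Fin (m + 2) → ι)) *
          (A ⊗ₖ A) p q *
          v (Fin.cons q.1 (Fin.cons q.2 r : Fin (m + 1) → ι) : Fin (m + 2) → ι)) := by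
    have h5 : ∀ F : ι × ι → ι × ι → (Fin m → ι) → ℂ,
        ∑ r, ∑ p, ∑ q, F p q r = ∑ q, ∑ p, ∑ r, F p q r := by
      intro F
      rw [Finset.sum_comm]
      simp only [Finset.sum_comm (s := (Finset.univ : Finset (Fin m → ι)))]
      rw [Finset.sum_comm]
    rw [h5]
    simp only [Fintype.sum_prod_type, Finset.mul_sum]
    refine Finset.sum_congr rfl fun a _ => Finset.sum_congr rfl fun b _ =>
      Finset.sum_congr rfl fun c _ => Finset.sum_congr rfl fun e _ =>
      Finset.sum_congr rfl fun r _ => ?_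
    rw [Matrix.kroneckerMap_apply]
    ring
  simp only [fock_sum_left, h3]
  rw [h4, h2]
  push_cast
  ring

end AntiWick

/-! ### Positivity of the anti-normal symbol -/

section DeFinetti

open MvPolynomial MeasureTheory

variable {ι : Type} [Fintype ι]

/-- The integrand of `antiWick A f`. -/
noncomputable def antiWickIntegrand (A : Matrix ι ι ℂ) (f : MvPolynomial ι ℂ) (z : ι → ℂ) : ℝ :=
  (∏ i, gaussDensity (z i)) * Complex.normSq (eval z f) * quadForm A (star z) ^ 2

/-- The factors depending on a and b form a perfect square. The form is taken at the conjugate of z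
because f(z) is the overlap of v with z̄^{⊗N}, so |f(z)|² is the coherent state density at z̄. -/
theorem sum_fockIntegrand_eq {A : Matrix ι ι ℂ} (hA : A.IsHermitian) (f : MvPolynomial ι ℂ)
    (z : ι → ℂ) :
    ∑ a, ∑ b, fockIntegrand (columnForm A a * (columnForm A b * f)) (X a * (X b * f)) z =
      (antiWickIntegrand A f z : ℂ) := by
  have h : (quadForm A (star z) : ℂ) = ∑ a, eval z (columnForm A a) * star (z a) := by
    rw [ofReal_quadForm hA, star_star, dotProduct]
    simp only [Matrix.mulVec, dotProduct, Finset.mul_sum, columnForm, map_sum, Finset.sum_mul]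
    rw [Finset.sum_comm]
    refine Finset.sum_congr rfl fun a _ => Finset.sum_congr rfl fun c _ => ?_
    simp only [map_mul, eval_C, eval_X, Pi.star_apply]
    ring
  rw [antiWickIntegrand]
  push_cast
  rw [h, sq, Finset.sum_mul_sum, Finset.mul_sum]
  refine Finset.sum_congr rfl fun a _ => ?_
  rw [Finset.mul_sum]
  refine Finset.sum_congr rfl fun b _ => ?_
  rw [fockIntegrand, ← Complex.mul_conj]
  simp only [map_mul, eval_X, star_mul', RCLike.star_def]
  push_cast
  ring

theorem integrable_antiWickIntegrand {A : Matrix ι ι ℂ} (hA : A.IsHermitian)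
    (f : MvPolynomial ι ℂ) : Integrable (antiWickIntegrand A f) := by
  have h : Integrable fun z => ∑ a, ∑ b,
      fockIntegrand (columnForm A a * (columnForm A b * f)) (X a * (X b * f)) z :=
    integrable_finsetSum _ fun a _ => integrable_finsetSum _ fun b _ =>
      integrable_fockIntegrand _ _
  simp only [sum_fockIntegrand_eq hA] at h
  simpa using h.re

theorem antiWick_eq_integral {A : Matrix ι ι ℂ} (hA : A.IsHermitian) (f : MvPolynomial ι ℂ) :
    antiWick A f = ((∫ z, antiWickIntegrand A f z : ℝ) : ℂ) := by
  rw [← integral_complex_ofReal]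
  simp only [← sum_fockIntegrand_eq hA]
  rw [integral_finsetSum _ fun a _ => integrable_finsetSum _ fun b _ =>
    integrable_fockIntegrand _ _]
  refine Finset.sum_congr rfl fun a _ => ?_
  rw [integral_finsetSum _ fun b _ => integrable_fockIntegrand _ _]
  rfl

theorem quadForm_one [DecidableEq ι] (v : ι → ℂ) : quadForm 1 v = normSq v := by
  rw [quadForm, Matrix.one_mulVec, star_dotProduct_self, Complex.ofReal_re]

/-- Anti-normal ordering is monotone. -/
theorem sum_antiWick_le [DecidableEq ι] {κ : Type*} [Fintype κ] {A : κ → Matrix ι ι ℂ}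
    (hA : ∀ i, (A i).IsHermitian) {w : κ → ℝ} {b : ℝ}
    (hb : ∀ ψ : ι → ℂ, ∑ i, w i * quadForm (A i) ψ ^ 2 ≤ b * normSq ψ ^ 2)
    (f : MvPolynomial ι ℂ) :
    ∑ i, w i * (antiWick (A i) f).re ≤ b * (antiWick 1 f).re := by
  simp only [antiWick_eq_integral (hA _), antiWick_eq_integral Matrix.isHermitian_one,
    Complex.ofReal_re, ← integral_const_mul]
  rw [← integral_finsetSum _ fun i _ => (integrable_antiWickIntegrand (hA i) f).const_mul _]
  refine integral_mono (integrable_finsetSum _ fun i _ =>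
    (integrable_antiWickIntegrand (hA i) f).const_mul _)
    ((integrable_antiWickIntegrand Matrix.isHermitian_one f).const_mul _) fun z => ?_
  have h := mul_le_mul_of_nonneg_left (hb (star z)) (mul_nonneg
    (Finset.prod_nonneg fun i (_ : i ∈ Finset.univ) => gaussDensity_nonneg (z i))
    (Complex.normSq_nonneg (eval z f)))
  simp only [antiWickIntegrand, quadForm_one]
  calc _ = _ := ?_
    _ ≤ _ := h
    _ = _ := by ring
  rw [Finset.mul_sum]
  exact Finset.sum_congr rfl fun i _ => by ring

variable [DecidableEq ι]

theorem columnForm_one (a : ι) : columnForm (1 : Matrix ι ι ℂ) a = X a := by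
  rw [columnForm, Finset.sum_eq_single a]
  · simp
  · intro c _ hc; simp [Matrix.one_apply_ne hc]
  · simp

/-- For A = 1 the scalar is d² + 2dN + d + 2N + N(N-1) = (N+d)(N+d+1), where N = m + 2. -/
theorem antiWick_one_symPoly {m : ℕ} {v : (Fin (m + 2) → ι) → ℂ}
    (hv : v ∈ symSubspace ι (m + 2)) :
    (antiWick 1 (symPoly v)).re = (m + 2).factorial *
      ((m + 2 + Fintype.card ι) * (m + 3 + Fintype.card ι)) * normSq v := by
  have ht : C (1 : Matrix ι ι ℂ).trace * ∑ a, columnForm 1 a * pderiv a (symPoly v) =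
      C (Fintype.card ι * (m + 2) : ℂ) * symPoly v := by
    simp only [columnForm_one]
    rw [sum_X_mul_pderiv_symPoly hv, Matrix.trace_one, C_mul]
    push_cast
    ring
  rw [antiWick_symPoly (mul_one 1) hv ht, Matrix.one_kronecker_one]
  have h1 : extendOp m (1 : Matrix (ι × ι) (ι × ι) ℂ) = 1 := by
    rw [extendOp_eq_submatrix, Matrix.one_kronecker_one, Matrix.submatrix_one_equiv]
  rw [h1, Matrix.one_mulVec, star_dotProduct_self, Matrix.trace_one]
  norm_cast
  push_cast
  ring

end DeFinetti

/-! ### The rate of convergence -/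

section Rate

open MvPolynomial

variable {n ℓ : ℕ} (S : Fin n → PauliString ℓ) {w : Fin n → ℝ}

/-- Only nonnegative scalar terms are dropped. The cross term tr(A) dΓ(A) is d(m+2) for the identity
string and zero for a traceless one. -/
theorem le_antiWick_symPoly (s : PauliString ℓ) {m : ℕ} {v : (Fin (m + 2) → Bits ℓ) → ℂ}
    (hv : v ∈ symSubspace (Bits ℓ) (m + 2)) :
    (m + 2).factorial * ((m + 2) * (m + 1) * quadForm (extendOp m (s.mat ⊗ₖ s.mat)) v) ≤
      (antiWick s.mat (symPoly v)).re := by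
  have hH : (extendOp m (s.mat ⊗ₖ s.mat)).IsHermitian := by
    apply extendOp_isHermitian
    rw [Matrix.IsHermitian, Matrix.conjTranspose_kronecker, s.mat_isHermitian.eq]
  obtain ⟨t, T, hT, htpos, ht⟩ : ∃ t T : ℝ, s.mat.trace = (T : ℂ) ∧ 0 ≤ t ∧
      C s.mat.trace * ∑ a, columnForm s.mat a * pderiv a (symPoly v) =
        C (t : ℂ) * symPoly v := by
    rcases s.mat_eq_one_or_trace_eq_zero with h | h
    · refine ⟨Fintype.card (Bits ℓ) * (m + 2), Fintype.card (Bits ℓ), ?_, by positivity, ?_⟩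
      · rw [h, Matrix.trace_one]; simp
      · simp only [h, columnForm_one]
        rw [sum_X_mul_pderiv_symPoly hv, Matrix.trace_one, Complex.ofReal_mul, C_mul]
        push_cast
        ring
    · exact ⟨0, 0, by simp [h], le_rfl, by simp [h]⟩
  rw [antiWick_symPoly s.mat_mul_self hv ht, ← ofReal_quadForm hH, hT]
  have h : ((m + 2).factorial : ℂ) * (((T : ℂ) ^ 2 + 2 * t + Fintype.card (Bits ℓ) + 2 * (m + 2)) *
      normSq v + (m + 2) * (m + 1) * (quadForm (extendOp m (s.mat ⊗ₖ s.mat)) v)) =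
      (((m + 2).factorial * ((T ^ 2 + 2 * t + Fintype.card (Bits ℓ) + 2 * (m + 2)) *
      normSq v + (m + 2) * (m + 1) * quadForm (extendOp m (s.mat ⊗ₖ s.mat)) v) : ℝ) : ℂ) := by
    push_cast
    ring
  rw [h, Complex.ofReal_re]
  refine mul_le_mul_of_nonneg_left (le_add_of_nonneg_left ?_) (Nat.cast_nonneg _)
  exact mul_nonneg (by positivity) (normSq_nonneg v)

theorem extensionBound_mul_le (hw : ∀ i, 0 ≤ w i) (m : ℕ) :
    (m + 2) * (m + 1) * extensionBound S w m ≤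
      betaNumber S w * ((m + 2 + 2 ^ ℓ) * (m + 3 + 2 ^ ℓ)) := by
  obtain ⟨v, hv, hv1, hvc⟩ := exists_quadForm_eq_extensionBound S w m
  have h := sum_antiWick_le (fun i => (S i).mat_isHermitian)
    (sum_mul_quadForm_sq_le_betaNumber S hw) (symPoly v)
  rw [antiWick_one_symPoly hv, hv1, mul_one] at h
  have h2 := (Finset.sum_le_sum fun i (_ : i ∈ Finset.univ) =>
    mul_le_mul_of_nonneg_left (le_antiWick_symPoly (S i) hv) (hw i)).trans h
  have h3 : ∑ i, w i * ((m + 2).factorial *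
      ((m + 2) * (m + 1) * quadForm (extendOp m ((S i).mat ⊗ₖ (S i).mat)) v)) =
      (m + 2).factorial * ((m + 2) * (m + 1) * extensionBound S w m) := by
    rw [← hvc, quadForm_extendOp_pairHamiltonian, Finset.mul_sum, Finset.mul_sum]
    exact Finset.sum_congr rfl fun i _ => by ring
  have hcard : (Fintype.card (Bits ℓ) : ℝ) = 2 ^ ℓ := by simp
  rw [h3, hcard, mul_left_comm (betaNumber S w)] at h2
  exact le_of_mul_le_mul_left h2 (by positivity)

theorem extensionBound_sub_betaNumber_le (hw : ∀ i, 0 ≤ w i) {m : ℕ} (hm : 1 ≤ m) :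
    extensionBound S w m - betaNumber S w ≤ 6 * (∑ i, w i) * (2 ^ ℓ / m) := by
  have hβ := betaNumber_nonneg S hw
  have hc := extensionBound_le_sum S hw m
  have hβc := betaNumber_le_extensionBound S hw m
  have hm' : (1 : ℝ) ≤ m := by exact_mod_cast hm
  have hd : (1 : ℝ) ≤ 2 ^ ℓ := one_le_pow₀ one_le_two
  have h := extensionBound_mul_le S hw m
  set d : ℝ := 2 ^ ℓ
  set c := extensionBound S w m
  set β := betaNumber S w
  set W := ∑ i, w i
  have hW : 0 ≤ W := Finset.sum_nonneg fun i _ => hw i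
  rw [← mul_div_assoc, le_div_iff₀ (by linarith)]
  rcases le_total d m with hdm | hdm
  · have h1 : (m + 2) * (m + 1) * (c - β) ≤ β * (6 * d * (m + 2)) := by
      -- The difference is 2(m+2) + d(2m+5) + d². For 1 ≤ d ≤ m its terms are at most 2, 3 and 1
      -- times d(m+2), which is the origin of the constant 6.
      have h2 : (m + 2 + d) * (m + 3 + d) - (m + 2) * (m + 1) ≤ 6 * d * (m + 2) := by nlinarith
      nlinarith [mul_le_mul_of_nonneg_left h2 hβ]
    have h3 : (m + 1) * (c - β) ≤ β * (6 * d) := by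
      have : (0 : ℝ) < m + 2 := by linarith
      nlinarith
    have h4 : β * (6 * d) ≤ W * (6 * d) :=
      mul_le_mul_of_nonneg_right (hβc.trans hc) (by linarith)
    nlinarith
  -- For m ≤ d the trivial bound c - β ≤ W is enough.
  · have h1 : (c - β) * m ≤ W * m := mul_le_mul_of_nonneg_right (by linarith) (by linarith)
    have h2 : W * m ≤ W * d := mul_le_mul_of_nonneg_left hdm hW
    have h3 : 0 ≤ W * d := mul_nonneg hW (by linarith)
    nlinarith

theorem tendsto_extensionBound (hw : ∀ i, 0 ≤ w i) :
    Filter.Tendsto (extensionBound S w) Filter.atTop (nhds (betaNumber S w)) := by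
  have h0 : Filter.Tendsto (fun m : ℕ => betaNumber S w + 6 * (∑ i, w i) * (2 ^ ℓ / m))
      Filter.atTop (nhds (betaNumber S w + 6 * (∑ i, w i) * 0)) :=
    ((tendsto_const_div_atTop_nhds_zero_nat _).const_mul _).const_add _
  rw [mul_zero, add_zero] at h0
  refine tendsto_of_tendsto_of_tendsto_of_le_of_le' tendsto_const_nhds h0
    (Filter.Eventually.of_forall (betaNumber_le_extensionBound S hw)) ?_
  filter_upwards [Filter.eventually_ge_atTop 1] with m hm
  linarith [extensionBound_sub_betaNumber_le S hw hm]

end Rate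

/-! ### Matrix entries in terms of occupation numbers -/

section Entries

/-- The entries of one Pauli matrix are all in {0, ±1}, or, for Y, all in {0, ±i}; either way
products of two are integers. This makes the reduced matrix real and computable without complex
arithmetic or real constants. -/
theorem Pauli.mat_mul_mat_mem_range (p : Pauli) (a b c e : Fin 2) :
    p.mat a c * p.mat b e ∈ (Int.castRingHom ℂ).range := by
  have h0 : (0 : ℂ) ∈ (Int.castRingHom ℂ).range := zero_mem _
  have h1 : (1 : ℂ) ∈ (Int.castRingHom ℂ).range := one_mem _
  have h2 : (-1 : ℂ) ∈ (Int.castRingHom ℂ).range := neg_mem (one_mem _)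
  cases p <;> fin_cases a <;> fin_cases b <;> fin_cases c <;> fin_cases e <;>
    simp [Pauli.mat, h0, h1]

theorem PauliString.exists_int_eq_mul {ℓ : ℕ} (s : PauliString ℓ) (a b c e : Bits ℓ) :
    ∃ k : ℤ, s.mat a c * s.mat b e = k := by
  have : s.mat a c * s.mat b e ∈ (Int.castRingHom ℂ).range := by
    rw [PauliString.mat_apply, PauliString.mat_apply, ← Finset.prod_mul_distrib]
    exact Subring.prod_mem _ fun k _ => Pauli.mat_mul_mat_mem_range _ _ _ _ _
  obtain ⟨k, hk⟩ := this
  exact ⟨k, hk.symm⟩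

/-- The entry `S a c * S b e` of `S ⊗ S`, which is an integer. -/
noncomputable def PauliString.pairEntry {ℓ : ℕ} (s : PauliString ℓ) (p q : Bits ℓ × Bits ℓ) : ℤ :=
  (s.exists_int_eq_mul p.1 p.2 q.1 q.2).choose

theorem PauliString.pairEntry_spec {ℓ : ℕ} (s : PauliString ℓ) (p q : Bits ℓ × Bits ℓ) :
    s.mat p.1 q.1 * s.mat p.2 q.2 = s.pairEntry p q :=
  (s.exists_int_eq_mul p.1 p.2 q.1 q.2).choose_spec

variable {ι : Type} [DecidableEq ι]

/-- The occupation numbers of the two-element multiset of the entries of `p`. -/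
def pairCount (p : ι × ι) (a : ι) : ℕ := (if a = p.1 then 1 else 0) + (if a = p.2 then 1 else 0)

theorem count_cons_cons {m : ℕ} (p : ι × ι) (u : Sym ι m) (a : ι) :
    Multiset.count a ((p.1 ::ₛ p.2 ::ₛ u : Sym ι (m + 2)) : Multiset ι) =
      Multiset.count a (u : Multiset ι) + pairCount p a := by
  rw [Sym.coe_cons, Sym.coe_cons, Multiset.count_cons, Multiset.count_cons, pairCount]
  ring

theorem exists_eq_cons_cons {m : ℕ} {s : Sym ι (m + 2)} {p : ι × ι}
    (h : ∀ a, pairCount p a ≤ Multiset.count a (s : Multiset ι)) :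
    ∃ u : Sym ι m, s = p.1 ::ₛ p.2 ::ₛ u := by
  have hle : (p.1 ::ₘ p.2 ::ₘ 0) ≤ (s : Multiset ι) := by
    rw [Multiset.le_iff_count]
    intro a
    refine le_trans (le_of_eq ?_) (h a)
    rw [Multiset.count_cons, Multiset.count_cons, pairCount, Multiset.count_zero]
    ring
  obtain ⟨u, hu⟩ := Multiset.le_iff_exists_add.1 hle
  have hcard : Multiset.card u = m := by
    have := congrArg Multiset.card hu
    simp only [Sym.card_coe, Multiset.card_add, Multiset.card_cons, Multiset.card_zero] at this
    omega
  refine ⟨Sym.mk u hcard, Sym.ext ?_⟩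
  rw [hu, Sym.coe_cons, Sym.coe_cons]
  simp

variable [Fintype ι]

/-- The number of sequences `r` such that `s` arises from `r` by adding `p`, and `t` by
adding `q`. -/
theorem card_common_rest {m : ℕ} (s t : Sym ι (m + 2)) (p q : ι × ι) :
    ((Finset.univ.filter fun r : Fin m → ι => p.1 ::ₛ p.2 ::ₛ occupation r = s ∧
      q.1 ::ₛ q.2 ::ₛ occupation r = t).card : ℝ) =
      (if ∀ a, pairCount p a ≤ Multiset.count a (s : Multiset ι) ∧
        Multiset.count a (s : Multiset ι) + pairCount q a =
          Multiset.count a (t : Multiset ι) + pairCount p a then 1 else 0) *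
      (m.factorial / ∏ a, ((Multiset.count a (s : Multiset ι) - pairCount p a).factorial : ℝ)) := by
  -- The condition says that s - p and t - q are one and the same multiset `u`. It is stated
  -- additively, since truncated subtraction is faithful only where p is contained in s.
  split_ifs with h
  · obtain ⟨u, rfl⟩ := exists_eq_cons_cons fun a => (h a).1
    have ht : t = q.1 ::ₛ q.2 ::ₛ u := by
      apply Sym.ext
      ext a
      have := (h a).2
      rw [count_cons_cons] at this ⊢
      omega
    subst ht
    simp only [Sym.cons_inj_right, and_self, count_cons_cons, Nat.add_sub_cancel, one_mul]
    rw [eq_div_iff (Finset.prod_ne_zero_iff.2 fun a _ => by positivity)]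
    exact_mod_cast card_occupation_mul_prod_factorial u
  · rw [zero_mul, Nat.cast_eq_zero, Finset.card_eq_zero, Finset.filter_eq_empty_iff]
    rintro r - ⟨rfl, rfl⟩
    apply h
    intro a
    rw [count_cons_cons, count_cons_cons]
    omega

/-- The entry of the Gram matrix in terms of occupation numbers. -/
noncomputable def gramEntry (m : ℕ) (σ τ : ι → ℕ) : ℝ :=
  (if ∀ a, σ a = τ a then 1 else 0) * ((m + 2).factorial / ∏ a, ((σ a).factorial : ℝ))

theorem gramMatrix_apply {ℓ m : ℕ} (s t : Sym (Bits ℓ) (m + 2)) :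
    gramMatrix ℓ m s t = (gramEntry m (fun a => Multiset.count a (s : Multiset (Bits ℓ)))
      (fun a => Multiset.count a (t : Multiset (Bits ℓ))) : ℂ) := by
  have hst : (∀ a, Multiset.count a (s : Multiset (Bits ℓ)) =
      Multiset.count a (t : Multiset (Bits ℓ))) ↔ s = t := by
    rw [← Multiset.ext]; exact Sym.coe_inj
  simp only [gramEntry, hst]
  have h1 : gramMatrix ℓ m s t = if s = t then
      ((Finset.univ.filter fun x : Fin (m + 2) → Bits ℓ => occupation x = s).card : ℂ) else 0 := by
    simp only [gramMatrix, dotProduct, Pi.star_apply, dickeVector]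
    split_ifs with h
    · subst h
      rw [Finset.card_filter, Nat.cast_sum]
      refine Finset.sum_congr rfl fun x _ => ?_
      split_ifs <;> simp
    · refine Finset.sum_eq_zero fun x _ => ?_
      by_cases hx : occupation x = s
      · rw [if_neg (fun h' => h (hx.symm.trans h')), mul_zero]
      · rw [if_neg hx, star_zero, zero_mul]
  rw [h1]
  split_ifs with h
  · have h2 := card_occupation_mul_prod_factorial s
    have h3 : ((Finset.univ.filter fun x : Fin (m + 2) → Bits ℓ => occupation x = s).card : ℝ) =
        (m + 2).factorial / ∏ a, ((Multiset.count a (s : Multiset (Bits ℓ))).factorial : ℝ) := by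
      rw [eq_div_iff (Finset.prod_ne_zero_iff.2 fun a _ => by positivity)]
      exact_mod_cast h2
    rw [one_mul, ← h3, Complex.ofReal_natCast]
  · simp

/-- The entry of the reduced matrix in terms of occupation numbers. -/
noncomputable def reducedEntry {n ℓ : ℕ} (S : Fin n → PauliString ℓ) (w : Fin n → ℝ) (m : ℕ)
    (σ τ : Bits ℓ → ℕ) : ℝ :=
  ∑ p : Bits ℓ × Bits ℓ, ∑ q : Bits ℓ × Bits ℓ,
    (∑ i, ((S i).pairEntry p q : ℝ) * w i) *
      ((if ∀ a, pairCount p a ≤ σ a ∧ σ a + pairCount q a = τ a + pairCount p a then 1 else 0) *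
        (m.factorial / ∏ a, ((σ a - pairCount p a).factorial : ℝ)))

/-- Sum over the first two entries p and q of both sequences; the other m entries coincide, and the
admissible ones are counted by `card_common_rest`. -/
theorem reducedMatrix_apply {n ℓ : ℕ} (S : Fin n → PauliString ℓ) (w : Fin n → ℝ) (m : ℕ)
    (s t : Sym (Bits ℓ) (m + 2)) :
    reducedMatrix S w m s t =
      (reducedEntry S w m (fun a => Multiset.count a (s : Multiset (Bits ℓ)))
        (fun a => Multiset.count a (t : Multiset (Bits ℓ))) : ℂ) := by
  rw [reducedMatrix, dotProduct_extendOp, Finset.sum_comm, reducedEntry, Complex.ofReal_sum]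
  refine Finset.sum_congr rfl fun p _ => ?_
  rw [Finset.sum_comm, Complex.ofReal_sum]
  refine Finset.sum_congr rfl fun q _ => ?_
  rw [← card_common_rest]
  have hH : pairHamiltonian S w p q = ((∑ i, ((S i).pairEntry p q : ℝ) * w i : ℝ) : ℂ) := by
    rw [pairHamiltonian, Matrix.sum_apply, Complex.ofReal_sum]
    refine Finset.sum_congr rfl fun i _ => ?_
    rw [Matrix.smul_apply, Matrix.kroneckerMap_apply, PauliString.pairEntry_spec, smul_eq_mul]
    push_cast
    ring
  rw [Complex.ofReal_mul, ← hH, Complex.ofReal_natCast, Finset.card_filter, Nat.cast_sum,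
    Finset.mul_sum]
  refine Finset.sum_congr rfl fun r _ => ?_
  simp only [dickeVector, occupation_cons]
  split_ifs <;> simp_all

end Entries

/-! ### Polynomial bounds for the cost of expressions -/

section CostBounds

/-- All natural numbers in the store are at most `V`. -/
def Store.BoundedBy (M : Store) (V : ℕ) : Prop :=
  (∀ i, M.reg i ≤ V) ∧ ∀ a k, M.arr a k ≤ V

theorem Store.BoundedBy.setReg {M : Store} {V : ℕ} (h : M.BoundedBy V) {i v : ℕ} (hv : v ≤ V) :
    (M.setReg i v).BoundedBy V := by
  refine ⟨fun j => ?_, h.2⟩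
  rcases eq_or_ne j i with rfl | hj
  · simpa [Store.setReg] using hv
  · simpa [Store.setReg, hj] using h.1 j

theorem Store.BoundedBy.setArr {M : Store} {V : ℕ} (h : M.BoundedBy V) {a k v : ℕ} (hv : v ≤ V) :
    (M.setArr a k v).BoundedBy V := by
  refine ⟨h.1, fun b l => ?_⟩
  rcases eq_or_ne b a with rfl | hb
  · rcases eq_or_ne l k with rfl | hl
    · simpa [Store.setArr] using hv
    · simpa [Store.setArr, hl] using h.2 b l
  · simpa [Store.setArr, hb] using h.2 b l

theorem Store.BoundedBy.setRarr {M : Store} {V : ℕ} (h : M.BoundedBy V) (a k : ℕ) (v : ℝ) :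
    (M.setRarr a k v).BoundedBy V := h

/-- A polynomial bound for the value of an expression in terms of a bound for the store. -/
noncomputable def NatExpr.valueBound : NatExpr → Polynomial ℕ
  | .const k => Polynomial.C k
  | .reg _ => Polynomial.X
  | .arr _ _ => Polynomial.X
  | .add e f => e.valueBound + f.valueBound
  | .sub e _ => e.valueBound
  | .mul e f => e.valueBound * f.valueBound
  | .div e _ => e.valueBound
  | .lt _ _ => 1
  | .eq _ _ => 1

theorem NatExpr.eval_le {M : Store} {V : ℕ} (h : M.BoundedBy V) (e : NatExpr) :
    e.eval M ≤ e.valueBound.eval V := by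
  induction e with
  | const k => simp [NatExpr.eval, NatExpr.valueBound]
  | reg i => simpa [NatExpr.eval, NatExpr.valueBound] using h.1 i
  | arr a e _ => simpa [NatExpr.eval, NatExpr.valueBound] using h.2 a _
  | add e f he hf =>
    simpa [NatExpr.eval, NatExpr.valueBound] using Nat.add_le_add he hf
  | sub e f he _ => exact (Nat.sub_le _ _).trans he
  | mul e f he hf =>
    simpa [NatExpr.eval, NatExpr.valueBound] using Nat.mul_le_mul he hf
  | div e f he _ => exact (Nat.div_le_self _ _).trans he
  | lt e f _ _ => simp only [NatExpr.eval, NatExpr.valueBound]; split_ifs <;> simp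
  | eq e f _ _ => simp only [NatExpr.eval, NatExpr.valueBound]; split_ifs <;> simp

/-- A crude bound of the bit length by the number itself; it suffices because all numbers in the
runs below are polynomial in m. -/
theorem size_le_of_le {k b : ℕ} (h : k ≤ b) : k.size ≤ b :=
  (Nat.size_le.2 k.lt_two_pow_self).trans h

/-- A polynomial bound for the cost of an expression. -/
theorem NatExpr.exists_cost_le (e : NatExpr) :
    ∃ p : Polynomial ℕ, ∀ (V : ℕ) (M : Store), M.BoundedBy V → e.cost M ≤ p.eval V := by
  induction e with
  | const k => exact ⟨Polynomial.C (1 + k.size), fun V M _ => by simp [NatExpr.cost]⟩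
  | reg i =>
    refine ⟨1 + Polynomial.X, fun V M h => ?_⟩
    simpa [NatExpr.cost] using size_le_of_le (h.1 i)
  | arr a e he =>
    obtain ⟨p, hp⟩ := he
    refine ⟨p + 1 + Polynomial.X, fun V M h => ?_⟩
    simp only [NatExpr.cost, Polynomial.eval_add, Polynomial.eval_one, Polynomial.eval_X]
    have := hp V M h
    have := size_le_of_le (h.2 a (e.eval M))
    omega
  | lt e f he hf | eq e f he hf =>
    obtain ⟨p, hp⟩ := he
    obtain ⟨q, hq⟩ := hf
    refine ⟨p + q + 2, fun V M h => ?_⟩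
    simp only [NatExpr.cost, Polynomial.eval_add, Polynomial.eval_ofNat]
    have := hp V M h
    have := hq V M h
    omega
  | add e f he hf =>
    obtain ⟨p, hp⟩ := he
    obtain ⟨q, hq⟩ := hf
    refine ⟨p + q + 1 + (NatExpr.add e f).valueBound, fun V M h => ?_⟩
    simp only [NatExpr.cost, Polynomial.eval_add, Polynomial.eval_one]
    have := hp V M h
    have := hq V M h
    have := size_le_of_le (NatExpr.eval_le h (.add e f))
    simp only [NatExpr.eval] at this
    omega
  | sub e f he hf =>
    obtain ⟨p, hp⟩ := he
    obtain ⟨q, hq⟩ := hf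
    refine ⟨p + q + 1 + (NatExpr.sub e f).valueBound, fun V M h => ?_⟩
    simp only [NatExpr.cost, Polynomial.eval_add, Polynomial.eval_one]
    have := hp V M h
    have := hq V M h
    have := size_le_of_le (NatExpr.eval_le h (.sub e f))
    simp only [NatExpr.eval] at this
    omega
  | mul e f he hf =>
    obtain ⟨p, hp⟩ := he
    obtain ⟨q, hq⟩ := hf
    refine ⟨p + q + 1 + (NatExpr.mul e f).valueBound, fun V M h => ?_⟩
    simp only [NatExpr.cost, Polynomial.eval_add, Polynomial.eval_one]
    have := hp V M h
    have := hq V M h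
    have := size_le_of_le (NatExpr.eval_le h (.mul e f))
    simp only [NatExpr.eval] at this
    omega
  | div e f he hf =>
    obtain ⟨p, hp⟩ := he
    obtain ⟨q, hq⟩ := hf
    refine ⟨p + q + 1 + (NatExpr.div e f).valueBound, fun V M h => ?_⟩
    simp only [NatExpr.cost, Polynomial.eval_add, Polynomial.eval_one]
    have := hp V M h
    have := hq V M h
    have := size_le_of_le (NatExpr.eval_le h (.div e f))
    simp only [NatExpr.eval] at this
    omega

theorem RealExpr.exists_cost_le (e : RealExpr) :
    ∃ p : Polynomial ℕ, ∀ (V : ℕ) (M : Store), M.BoundedBy V → e.cost M ≤ p.eval V := by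
  induction e with
  | ofNat e | arr a e =>
    obtain ⟨p, hp⟩ := e.exists_cost_le
    refine ⟨p + 1, fun V M h => ?_⟩
    simpa [RealExpr.cost] using hp V M h
  | add e f he hf | sub e f he hf | mul e f he hf | div e f he hf =>
    obtain ⟨p, hp⟩ := he
    obtain ⟨q, hq⟩ := hf
    refine ⟨p + q + 1, fun V M h => ?_⟩
    simp only [RealExpr.cost, Polynomial.eval_add, Polynomial.eval_one]
    have := hp V M h
    have := hq V M h
    omega

end CostBounds

/-! ### Runs of programs and loop invariants -/

section Runs

/-- Started in `M`, the program `P` halts with cost at most `C` in a store satisfying `Q`. -/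
def Runs (P : Program) (M : Store) (C : ℕ) (Q : Store → Prop) : Prop :=
  ∃ (c : ℕ) (M' : Store), Exec P M c M' ∧ c ≤ C ∧ Q M'

theorem Runs.mono {P : Program} {M : Store} {C C' : ℕ} {Q Q' : Store → Prop} (h : Runs P M C Q)
    (hC : C ≤ C') (hQ : ∀ M', Q M' → Q' M') : Runs P M C' Q' := by
  obtain ⟨c, M', he, hc, hq⟩ := h
  exact ⟨c, M', he, hc.trans hC, hQ _ hq⟩

theorem Runs.seq {P P' : Program} {M : Store} {C C' : ℕ} {Q Q' : Store → Prop}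
    (h : Runs P M C Q) (h' : ∀ M', Q M' → Runs P' M' C' Q') : Runs (.seq P P') M (C + C') Q' := by
  obtain ⟨c, M', he, hc, hq⟩ := h
  obtain ⟨c', M'', he', hc', hq'⟩ := h' M' hq
  exact ⟨c + c', M'', .seq he he', Nat.add_le_add hc hc', hq'⟩

theorem exec_loop_of_eq_zero {e : NatExpr} {P : Program} {M : Store} (h : e.eval M = 0) :
    Exec (.loop e P) M (e.cost M + 1) M := by
  constructor
  exact h

/-- `J j` is the invariant after j passes. The guard is evaluated T + 1 times and the body T times.
-/
theorem Runs.loop {e : NatExpr} {P : Program} {T G C : ℕ} {J : ℕ → Store → Prop}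
    (hstep : ∀ j < T, ∀ M, J j M → e.eval M ≠ 0 ∧ Runs P M C (J (j + 1)))
    (hend : ∀ M, J T M → e.eval M = 0) (hcost : ∀ j ≤ T, ∀ M, J j M → e.cost M ≤ G)
    {M : Store} (h0 : J 0 M) : Runs (.loop e P) M ((T + 1) * (G + 1 + C)) (J T) := by
  suffices ∀ k j M, j + k = T → J j M → Runs (.loop e P) M ((k + 1) * (G + 1 + C)) (J T) from
    this T 0 M (zero_add T) h0
  intro k
  induction k with
  | zero =>
    intro j M hj hM
    obtain rfl : j = T := by omega
    refine ⟨_, M, exec_loop_of_eq_zero (hend M hM), ?_, hM⟩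
    have := hcost j le_rfl M hM
    omega
  | succ k ih =>
    intro j M hj hM
    obtain ⟨hne, c, M', he, hc, hq⟩ := hstep j (by omega) M hM
    obtain ⟨c', M'', he', hc', hq'⟩ := ih (j + 1) M' (by omega) hq
    refine ⟨_, M'', .loop_step hne he he', ?_, hq'⟩
    have := hcost j (by omega) M hM
    rw [add_mul (k + 1) 1, one_mul]
    omega

/-- Programs without loops. -/
def Program.LoopFree : Program → Prop
  | .assign _ _ => True
  | .store _ _ _ => True
  | .rstore _ _ _ => True
  | .seq P Q => P.LoopFree ∧ Q.LoopFree
  | .cond _ P Q => P.LoopFree ∧ Q.LoopFree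
  | .loop _ _ => False

/-- The final store of a program without loops. -/
noncomputable def Program.result : Program → Store → Store
  | .assign i e, M => M.setReg i (e.eval M)
  | .store a e f, M => M.setArr a (e.eval M) (f.eval M)
  | .rstore a e f, M => M.setRarr a (e.eval M) (f.eval M)
  | .seq P Q, M => Q.result (P.result M)
  | .cond e P Q, M => if e.eval M = 0 then Q.result M else P.result M
  | .loop _ _, M => M

theorem Store.BoundedBy.mono {M : Store} {V V' : ℕ} (h : M.BoundedBy V) (hV : V ≤ V') :
    M.BoundedBy V' :=
  ⟨fun i => (h.1 i).trans hV, fun a k => (h.2 a k).trans hV⟩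

/-- A program without loops runs at a cost that is polynomial in any bound for the store. -/
theorem Program.LoopFree.exists_runs {P : Program} (hP : P.LoopFree) :
    ∃ p q : Polynomial ℕ, ∀ (V : ℕ) (M : Store), M.BoundedBy V →
      Runs P M (p.eval V) (fun M' => M' = P.result M ∧ M'.BoundedBy (q.eval V)) := by
  induction P with
  | assign i e =>
    obtain ⟨p, hp⟩ := e.exists_cost_le
    refine ⟨p + 1, e.valueBound + Polynomial.X, fun V M h => ⟨_, _, .assign i e M, ?_, rfl, ?_⟩⟩
    · simpa using hp V M h
    · simp only [Polynomial.eval_add, Polynomial.eval_X]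
      exact (h.mono (by omega)).setReg ((NatExpr.eval_le h e).trans (by omega))
  | store a e f =>
    obtain ⟨p, hp⟩ := e.exists_cost_le
    obtain ⟨q, hq⟩ := f.exists_cost_le
    refine ⟨p + q + 1, f.valueBound + Polynomial.X,
      fun V M h => ⟨_, _, .store a e f M, ?_, rfl, ?_⟩⟩
    · simpa using Nat.add_le_add (hp V M h) (hq V M h)
    · simp only [Polynomial.eval_add, Polynomial.eval_X]
      exact (h.mono (by omega)).setArr ((NatExpr.eval_le h f).trans (by omega))
  | rstore a e f =>
    obtain ⟨p, hp⟩ := e.exists_cost_le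
    obtain ⟨q, hq⟩ := f.exists_cost_le
    refine ⟨p + q + 1, Polynomial.X, fun V M h => ⟨_, _, .rstore a e f M, ?_, rfl, ?_⟩⟩
    · simpa using Nat.add_le_add (hp V M h) (hq V M h)
    · simpa using h.setRarr a _ _
  | seq P Q ihP ihQ =>
    obtain ⟨p, q, hp⟩ := ihP hP.1
    obtain ⟨p', q', hp'⟩ := ihQ hP.2
    -- The second program starts in a store bounded by q(V), not by V.
    refine ⟨p + p'.comp q, q'.comp q, fun V M h => ?_⟩
    simp only [Polynomial.eval_add, Polynomial.eval_comp]
    refine (hp V M h).seq fun M' hM' => ?_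
    refine (hp' _ M' hM'.2).mono le_rfl fun M'' hM'' => ?_
    rw [hM'.1] at hM''
    exact hM''
  | cond e P Q ihP ihQ =>
    obtain ⟨r, hr⟩ := e.exists_cost_le
    obtain ⟨p, q, hp⟩ := ihP hP.1
    obtain ⟨p', q', hp'⟩ := ihQ hP.2
    refine ⟨r + 1 + p + p', q + q', fun V M h => ?_⟩
    simp only [Polynomial.eval_add, Polynomial.eval_one]
    have hc := hr V M h
    by_cases he : e.eval M = 0
    · obtain ⟨c, M', hE, hcost, hM', hb⟩ := hp' V M h
      refine ⟨_, M', .cond_false he hE, by omega, ?_, hb.mono (by omega)⟩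
      rw [hM', Program.result, if_pos he]
    · obtain ⟨c, M', hE, hcost, hM', hb⟩ := hp V M h
      refine ⟨_, M', .cond_true he hE, by omega, ?_, hb.mono (by omega)⟩
      rw [hM', Program.result, if_neg he]
  | loop e P _ => exact hP.elim

/-- A loop with a loop-free body runs at a cost that is polynomial in the number of iterations and
in any bound for the store that holds throughout. -/
theorem exists_loop_runs (e : NatExpr) {P : Program} (hP : P.LoopFree) :
    ∃ p : Polynomial ℕ, ∀ (V T : ℕ) (J : ℕ → Store → Prop), T ≤ V →
      (∀ j ≤ T, ∀ M, J j M → M.BoundedBy V) →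
      (∀ j < T, ∀ M, J j M → e.eval M ≠ 0 ∧ J (j + 1) (P.result M)) →
      (∀ M, J T M → e.eval M = 0) →
      ∀ M, J 0 M → Runs (.loop e P) M (p.eval V) (J T) := by
  obtain ⟨r, hr⟩ := e.exists_cost_le
  obtain ⟨p, q, hp⟩ := hP.exists_runs
  -- The growth bound `q` of a single pass is discarded: iterating it need not stay polynomial. The
  -- invariant restores the bound V at every pass.
  refine ⟨(Polynomial.X + 1) * (r + 1 + p), fun V T J hT hb hstep hend M hM => ?_⟩
  refine (Runs.loop (G := r.eval V) (C := p.eval V) (fun j hj M hM => ?_) hend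
    (fun j hj M hM => hr V M (hb j hj M hM)) hM).mono ?_ fun _ h => h
  · obtain ⟨hne, hJ⟩ := hstep j hj M hM
    exact ⟨hne, (hp V M (hb j hj.le M hM)).mono le_rfl fun M' hM' => hM'.1 ▸ hJ⟩
  · simp only [Polynomial.eval_mul, Polynomial.eval_add, Polynomial.eval_X, Polynomial.eval_one]
    gcongr

end Runs

/-! ### Finite sums and products of expressions -/

section BigOperators

variable {κ : Type} [Fintype κ]

/-- The sum of a finite family of expressions. -/
noncomputable def NatExpr.sum (f : κ → NatExpr) : NatExpr :=
  (Finset.univ.toList.map f).foldr .add (.const 0)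

/-- The product of a finite family of expressions. -/
noncomputable def NatExpr.prod (f : κ → NatExpr) : NatExpr :=
  (Finset.univ.toList.map f).foldr .mul (.const 1)

/-- The sum of a finite family of expressions. -/
noncomputable def RealExpr.sum (f : κ → RealExpr) : RealExpr :=
  (Finset.univ.toList.map f).foldr .add (.ofNat (.const 0))

/-- The product of a finite family of expressions. -/
noncomputable def RealExpr.prod (f : κ → RealExpr) : RealExpr :=
  (Finset.univ.toList.map f).foldr .mul (.ofNat (.const 1))

theorem NatExpr.eval_sum (M : Store) (f : κ → NatExpr) :
    (NatExpr.sum f).eval M = ∑ k, (f k).eval M := by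
  have h : ∀ l : List κ, ((l.map f).foldr NatExpr.add (.const 0)).eval M =
      (l.map fun k => (f k).eval M).sum := by
    intro l
    induction l with
    | nil => rfl
    | cons a l ih => simp [NatExpr.eval, ih]
  rw [NatExpr.sum, h, Finset.sum_map_toList]

theorem NatExpr.eval_prod (M : Store) (f : κ → NatExpr) :
    (NatExpr.prod f).eval M = ∏ k, (f k).eval M := by
  have h : ∀ l : List κ, ((l.map f).foldr NatExpr.mul (.const 1)).eval M =
      (l.map fun k => (f k).eval M).prod := by
    intro l
    induction l with
    | nil => rfl
    | cons a l ih => simp [NatExpr.eval, ih]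
  rw [NatExpr.prod, h, Finset.prod_map_toList]

theorem RealExpr.eval_sum (M : Store) (f : κ → RealExpr) :
    (RealExpr.sum f).eval M = ∑ k, (f k).eval M := by
  have h : ∀ l : List κ, ((l.map f).foldr RealExpr.add (.ofNat (.const 0))).eval M =
      (l.map fun k => (f k).eval M).sum := by
    intro l
    induction l with
    | nil => simp [RealExpr.eval, NatExpr.eval]
    | cons a l ih => simp [RealExpr.eval, ih]
  rw [RealExpr.sum, h, Finset.sum_map_toList]

theorem RealExpr.eval_prod (M : Store) (f : κ → RealExpr) :
    (RealExpr.prod f).eval M = ∏ k, (f k).eval M := by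
  have h : ∀ l : List κ, ((l.map f).foldr RealExpr.mul (.ofNat (.const 1))).eval M =
      (l.map fun k => (f k).eval M).prod := by
    intro l
    induction l with
    | nil => simp [RealExpr.eval, NatExpr.eval]
    | cons a l ih => simp [RealExpr.eval, ih]
  rw [RealExpr.prod, h, Finset.prod_map_toList]

end BigOperators

/-! ### Multisets as digit strings -/

section Enumeration

/-- `q` has digit sum `m + 2` in base `m + 3`, the digits being those below position `d`. -/
def IsCode (d m q : ℕ) : Prop := ∑ j : Fin d, q / (m + 3) ^ (j : ℕ) % (m + 3) = m + 2

instance (d m : ℕ) : DecidablePred (IsCode d m) := fun _ => Nat.decEq _ _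

/-- The counting function starts at 0 and jumps by one exactly after a number satisfying `p`, so
every smaller value is the count at such a number. -/
theorem exists_count_eq {p : ℕ → Prop} [DecidablePred p] {k K : ℕ} (h : k < Nat.count p K) :
    ∃ q < K, p q ∧ Nat.count p q = k := by
  induction K with
  | zero => simp at h
  | succ K ih =>
    rw [Nat.count_succ] at h
    by_cases hk : k < Nat.count p K
    · obtain ⟨q, hq, h⟩ := ih hk
      exact ⟨q, by omega, h⟩
    · by_cases hp : p K
      · rw [if_pos hp] at h
        exact ⟨K, by omega, hp, by omega⟩
      · rw [if_neg hp] at h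
        omega

theorem digits_injective {d B q q' : ℕ} (hq : q < B ^ d) (hq' : q' < B ^ d)
    (h : ∀ j < d, q / B ^ j % B = q' / B ^ j % B) : q = q' := by
  have := (finFunctionFinEquiv (m := B) (n := d)).symm.injective
    (a₁ := ⟨q, hq⟩) (a₂ := ⟨q', hq'⟩)
    (by funext j; exact Fin.ext (h j j.2))
  exact congrArg Fin.val this

/-- The occupation numbers of the `k`-th basis vector are the digits of the `k`-th code. -/
theorem exists_equiv_sym (ℓ m : ℕ) :
    ∃ e : Fin (Nat.count (IsCode (2 ^ ℓ) m) ((m + 3) ^ 2 ^ ℓ)) ≃ Sym (Bits ℓ) (m + 2),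
      ∀ k : Fin (Nat.count (IsCode (2 ^ ℓ) m) ((m + 3) ^ 2 ^ ℓ)),
        ∃ q < (m + 3) ^ 2 ^ ℓ, IsCode (2 ^ ℓ) m q ∧ Nat.count (IsCode (2 ^ ℓ) m) q = k ∧
        ∀ a : Bits ℓ, q / (m + 3) ^ (finFunctionFinEquiv a : ℕ) % (m + 3) =
          Multiset.count a (e k : Multiset (Bits ℓ)) := by
  classical
  have hex : ∀ k : Fin (Nat.count (IsCode (2 ^ ℓ) m) ((m + 3) ^ 2 ^ ℓ)),
      ∃ q < (m + 3) ^ 2 ^ ℓ, IsCode (2 ^ ℓ) m q ∧ Nat.count (IsCode (2 ^ ℓ) m) q = k :=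
    fun k => exists_count_eq k.2
  choose code hlt hcode hcount using hex
  have hsym : ∀ k, ∃ s : Sym (Bits ℓ) (m + 2), ∀ a : Bits ℓ,
      code k / (m + 3) ^ (finFunctionFinEquiv a : ℕ) % (m + 3) =
        Multiset.count a (s : Multiset (Bits ℓ)) := by
    intro k
    let P : Bits ℓ → ℕ := fun a => code k / (m + 3) ^ (finFunctionFinEquiv a : ℕ) % (m + 3)
    have hP : ∑ a, P a = m + 2 := by
      rw [← hcode k]
      exact finFunctionFinEquiv.sum_comp
        fun j : Fin (2 ^ ℓ) => code k / (m + 3) ^ (j : ℕ) % (m + 3)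
    refine ⟨(Sym.equivNatSumOfFintype (Bits ℓ) (m + 2)).symm ⟨P, hP⟩, fun a => ?_⟩
    rw [← Sym.coe_equivNatSumOfFintype_apply_apply, Equiv.apply_symm_apply]
  choose f hf using hsym
  have hbij : Function.Bijective f := by
    constructor
    · intro k k' h
      apply Fin.ext
      rw [← hcount k, ← hcount k']
      congr 1
      refine digits_injective (hlt k) (hlt k') fun j hj => ?_
      have h1 := hf k (finFunctionFinEquiv.symm ⟨j, hj⟩)
      have h2 := hf k' (finFunctionFinEquiv.symm ⟨j, hj⟩)
      rw [Equiv.apply_symm_apply] at h1 h2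
      rw [h1, h2, h]
    · intro s
      -- A multiplicity is at most m + 2, so it is a digit in base m + 3 and no carries occur.
      have hle : ∀ a : Bits ℓ, Multiset.count a (s : Multiset (Bits ℓ)) < m + 3 := by
        intro a
        have := Multiset.count_le_card a (s : Multiset (Bits ℓ))
        rw [Sym.card_coe] at this
        omega
      let g : Fin (2 ^ ℓ) → Fin (m + 3) := fun j =>
        ⟨Multiset.count (finFunctionFinEquiv.symm j) (s : Multiset (Bits ℓ)), hle _⟩
      have hg : ∀ j : Fin (2 ^ ℓ),
          (finFunctionFinEquiv g : ℕ) / (m + 3) ^ (j : ℕ) % (m + 3) = g j := by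
        intro j
        rw [← finFunctionFinEquiv_symm_apply_val, Equiv.symm_apply_apply]
      have hc : IsCode (2 ^ ℓ) m (finFunctionFinEquiv g : ℕ) := by
        rw [IsCode, Finset.sum_congr rfl fun j _ => hg j]
        rw [finFunctionFinEquiv.symm.sum_comp
          fun a => Multiset.count a (s : Multiset (Bits ℓ)),
          Multiset.sum_count_eq_card fun a _ => Finset.mem_univ a, Sym.card_coe]
      refine ⟨⟨Nat.count (IsCode (2 ^ ℓ) m) (finFunctionFinEquiv g : ℕ),
        Nat.count_strict_mono hc (finFunctionFinEquiv g).2⟩, ?_⟩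
      set k : Fin (Nat.count (IsCode (2 ^ ℓ) m) ((m + 3) ^ 2 ^ ℓ)) :=
        ⟨Nat.count (IsCode (2 ^ ℓ) m) (finFunctionFinEquiv g : ℕ),
        Nat.count_strict_mono hc (finFunctionFinEquiv g).2⟩
      have hk : code k = finFunctionFinEquiv g :=
        Nat.count_injective (hcode k) hc (hcount k)
      apply Sym.ext
      ext a
      rw [← hf k a, hk, hg]
      simp [g]
  refine ⟨Equiv.ofBijective f hbij, fun k => ⟨code k, hlt k, hcode k, hcount k, hf k⟩⟩

end Enumeration

/-! ### The loop that lists the basis -/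

section EnumerationProgram

/-- The base `m + 3`. -/
def baseExpr : NatExpr := .add (.reg 1) (.const 3)

/-- The powers of the base. -/
def basePowExpr : ℕ → NatExpr
  | 0 => .const 1
  | j + 1 => .mul (basePowExpr j) baseExpr

/-- The digit of register `3` at position `j`. -/
def digitExpr (j : ℕ) : NatExpr :=
  .sub (.div (.reg 3) (basePowExpr j))
    (.mul (.div (.div (.reg 3) (basePowExpr j)) baseExpr) baseExpr)

theorem eval_basePowExpr (M : Store) (j : ℕ) : (basePowExpr j).eval M = (M.reg 1 + 3) ^ j := by
  induction j with
  | zero => rfl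
  | succ j ih => rw [basePowExpr, NatExpr.eval, ih, pow_succ]; rfl

theorem eval_digitExpr (M : Store) (j : ℕ) :
    (digitExpr j).eval M = M.reg 3 / (M.reg 1 + 3) ^ j % (M.reg 1 + 3) := by
  simp only [digitExpr, NatExpr.eval, eval_basePowExpr, baseExpr]
  rw [Nat.mod_eq_sub_mul_div, mul_comm (M.reg 1 + 3)]

/-- Store the first `j` digits of register `3` in the row of array `0` with the number in
register `0`. -/
def storeRow (d : ℕ) : ℕ → Program
  -- A substitute for the empty program; register `2`, the counter of the factorial loop, is free by
  -- then.
  | 0 => .assign 2 (.const 0)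
  | j + 1 => .seq (storeRow d j)
      (.store 0 (.add (.mul (.reg 0) (.const d)) (.const j)) (digitExpr j))

theorem loopFree_storeRow (d j : ℕ) : (storeRow d j).LoopFree := by
  induction j with
  | zero => trivial
  | succ j ih => exact ⟨ih, trivial⟩

theorem result_storeRow (d j : ℕ) (M : Store) :
    (∀ i ≠ 2, ((storeRow d j).result M).reg i = M.reg i) ∧
    ((storeRow d j).result M).rarr = M.rarr ∧
    (∀ k < M.reg 0 * d, ((storeRow d j).result M).arr 0 k = M.arr 0 k) ∧
    (∀ i < j, ((storeRow d j).result M).arr 0 (M.reg 0 * d + i) =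
      M.reg 3 / (M.reg 1 + 3) ^ i % (M.reg 1 + 3)) ∧
    ∀ V, M.BoundedBy V → M.reg 1 + 2 ≤ V → ((storeRow d j).result M).BoundedBy V := by
  induction j with
  | zero =>
    refine ⟨fun i hi => ?_, rfl, fun _ _ => rfl, fun i hi => absurd hi (by omega),
      fun V h _ => h.setReg (Nat.zero_le _)⟩
    simp [storeRow, Program.result, Store.setReg, hi]
  | succ j ih =>
    obtain ⟨h1, h2, h3, h4, h5⟩ := ih
    have hidx : (NatExpr.add (.mul (.reg 0) (.const d)) (.const j)).eval ((storeRow d j).result M) =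
        M.reg 0 * d + j := by
      simp [NatExpr.eval, h1 0 (by omega)]
    have hdig : (digitExpr j).eval ((storeRow d j).result M) =
        M.reg 3 / (M.reg 1 + 3) ^ j % (M.reg 1 + 3) := by
      rw [eval_digitExpr, h1 3 (by omega), h1 1 (by omega)]
    simp only [storeRow, Program.result, hidx, hdig]
    refine ⟨h1, h2, fun k hk => ?_, fun i hi => ?_, fun V hV hm => (h5 V hV hm).setArr ?_⟩
    · have : k ≠ M.reg 0 * d + j := by omega
      simp [Store.setArr, this, h3 k hk]
    · rcases eq_or_ne i j with rfl | hij
      · simp [Store.setArr]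
      · simp [Store.setArr, hij, h4 i (by omega)]
    · have := Nat.mod_lt (M.reg 3 / (M.reg 1 + 3) ^ j) (by omega : M.reg 1 + 3 > 0)
      omega

/-- One step of the enumeration: if register `3` is a code, then store its digits. -/
noncomputable def enumBody (d : ℕ) : Program :=
  .seq
    (.cond (.eq (.sum fun j : Fin d => digitExpr j) (.add (.reg 1) (.const 2)))
      (.seq (storeRow d d) (.assign 0 (.add (.reg 0) (.const 1))))
      (.assign 2 (.const 0)))
    (.assign 3 (.add (.reg 3) (.const 1)))

theorem loopFree_enumBody (d : ℕ) : (enumBody d).LoopFree :=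
  ⟨⟨⟨loopFree_storeRow d d, trivial⟩, trivial⟩, trivial⟩

/-- What the later phases need to know about the earlier ones: the level, the weights and the
table of factorials. -/
structure Prepared {n : ℕ} (w : Fin n → ℝ) (m V : ℕ) (M : Store) : Prop where
  bounded : M.BoundedBy V
  level : M.reg 1 = m
  weights : ∀ i : Fin n, M.rarr 0 i = w i
  factorials : ∀ k ≤ m + 2, M.rarr 3 k = k.factorial

/-- The invariant of the enumeration. -/
structure EnumInv {n : ℕ} (w : Fin n → ℝ) (d m V q : ℕ) (M : Store) : Prop where
  prepared : Prepared w m V M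
  counter : M.reg 3 = q
  index : M.reg 4 = 0
  number : M.reg 0 = Nat.count (IsCode d m) q
  rows : ∀ q' < q, IsCode d m q' → ∀ j < d,
    M.arr 0 (Nat.count (IsCode d m) q' * d + j) = q' / (m + 3) ^ j % (m + 3)

theorem EnumInv.step {n : ℕ} {w : Fin n → ℝ} {d m V q : ℕ} {M : Store}
    (h : EnumInv w d m V q M) (hq : q < V) (hm : m + 2 ≤ V) :
    EnumInv w d m V (q + 1) ((enumBody d).result M) := by
  have hcond : (NatExpr.eq (.sum fun j : Fin d => digitExpr j)
      (.add (.reg 1) (.const 2))).eval M = if IsCode d m q then 1 else 0 := by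
    simp only [NatExpr.eval, NatExpr.eval_sum, eval_digitExpr, h.prepared.level, h.counter, IsCode]
  have hcount : Nat.count (IsCode d m) q ≤ q := Nat.count_le _
  by_cases hc : IsCode d m q
  · obtain ⟨h1, h2, h3, h4, h5⟩ := result_storeRow d d M
    have hb := h5 V h.prepared.bounded (by rw [h.prepared.level]; exact hm)
    simp only [enumBody, Program.result, hcond, if_pos hc, one_ne_zero, if_false]
    set M' := (storeRow d d).result M
    have r0 := h1 0 (by omega)
    have r1 := h1 1 (by omega)
    have r3 := h1 3 (by omega)
    have r4 := h1 4 (by omega)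
    rw [h.number] at r0 h3 h4
    rw [h.counter] at r3 h4
    rw [h.prepared.level] at r1 h4
    rw [h.index] at r4
    refine ⟨⟨?_, ?_, fun i => ?_, fun k hk => ?_⟩, ?_, ?_, ?_, fun q' hq' hcode j hj => ?_⟩
    · refine (hb.setReg ?_).setReg ?_
      · simp only [NatExpr.eval, r0]; omega
      · simp only [NatExpr.eval, Store.setReg, Function.update_of_ne (by omega : 3 ≠ 0), r3]; omega
    · simpa [Store.setReg] using r1
    · simpa [Store.setReg, h2] using h.prepared.weights i
    · simpa [Store.setReg, h2] using h.prepared.factorials k hk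
    · simp [Store.setReg, NatExpr.eval, r3]
    · simpa [Store.setReg] using r4
    · simp [Store.setReg, NatExpr.eval, r0, Nat.count_succ, hc]
    · change M'.arr 0 _ = _
      rcases (Nat.lt_succ_iff.1 hq').eq_or_lt with rfl | hlt
      · exact h4 j hj
      · rw [h3, h.rows q' hlt hcode j hj]
        -- An earlier code has a strictly smaller row number, so its row ends before the one just
        -- written begins.
        have := Nat.count_strict_mono hcode hlt
        calc _ < Nat.count (IsCode d m) q' * d + d := by omega
          _ = (Nat.count (IsCode d m) q' + 1) * d := by ring
          _ ≤ _ := Nat.mul_le_mul_right d this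
  · simp only [enumBody, Program.result, hcond, if_neg hc, if_true]
    refine ⟨⟨?_, ?_, h.prepared.weights, h.prepared.factorials⟩, ?_, ?_, ?_,
      fun q' hq' hcode j hj => ?_⟩
    · refine (h.prepared.bounded.setReg (Nat.zero_le _)).setReg ?_
      simp [NatExpr.eval, Store.setReg, h.counter]; omega
    · simpa [Store.setReg] using h.prepared.level
    · simp [Store.setReg, NatExpr.eval, h.counter]
    · simpa [Store.setReg] using h.index
    · simp [Store.setReg, h.number, Nat.count_succ, hc]
    · rcases (Nat.lt_succ_iff.1 hq').eq_or_lt with rfl | hlt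
      · exact absurd hcode hc
      · exact h.rows q' hlt hcode j hj

end EnumerationProgram

/-! ### The table of factorials -/

section FactorialProgram

/-- One step of the computation of the table of factorials. -/
def factorialBody : Program :=
  .seq
    (.rstore 3 (.add (.reg 2) (.const 1))
      (.mul (.arr 3 (.reg 2)) (.ofNat (.add (.reg 2) (.const 1)))))
    (.assign 2 (.add (.reg 2) (.const 1)))

/-- The invariant of the computation of the table of factorials. -/
structure FactorialInv {n : ℕ} (w : Fin n → ℝ) (m V j : ℕ) (M : Store) : Prop where
  bounded : M.BoundedBy V
  level : M.reg 1 = m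
  weights : ∀ i : Fin n, M.rarr 0 i = w i
  factorials : ∀ k ≤ j, M.rarr 3 k = k.factorial
  counter : M.reg 2 = j
  rest : M.reg 3 = 0 ∧ M.reg 4 = 0

theorem FactorialInv.step {n : ℕ} {w : Fin n → ℝ} {m V j : ℕ} {M : Store}
    (h : FactorialInv w m V j M) (hj : j < V) :
    FactorialInv w m V (j + 1) (factorialBody.result M) := by
  simp only [factorialBody, Program.result]
  refine ⟨?_, ?_, fun i => ?_, fun k hk => ?_, ?_, ?_⟩
  · refine (h.bounded.setRarr _ _ _).setReg ?_
    simp only [NatExpr.eval, Store.setRarr, h.counter]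
    omega
  · simpa [Store.setReg, Store.setRarr] using h.level
  · simpa [Store.setReg, Store.setRarr] using h.weights i
  · rcases hk.eq_or_lt with rfl | hlt
    · simp [Store.setReg, Store.setRarr, NatExpr.eval, RealExpr.eval, h.counter,
        h.factorials j le_rfl, Nat.factorial_succ, mul_comm]
    · simpa [Store.setReg, Store.setRarr, NatExpr.eval, h.counter, hlt.ne] using
        h.factorials k (by omega)
  · simp [Store.setReg, Store.setRarr, NatExpr.eval, h.counter]
  · simpa [Store.setReg, Store.setRarr] using h.rest

end FactorialProgram

/-! ### The loop that fills the matrices -/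

section MatrixProgram

variable {n ℓ : ℕ}

/-- An entry of the row of array `0` with the given number. -/
def rowExpr (k : NatExpr) (a : Bits ℓ) : NatExpr :=
  .arr 0 (.add (.mul k (.const (2 ^ ℓ))) (.const (finFunctionFinEquiv a : ℕ)))

/-- The row number of the matrix entry with the index in register `4`. -/
def leftExpr : NatExpr := .div (.reg 4) (.reg 0)

/-- The column number of the matrix entry with the index in register `4`. -/
def rightExpr : NatExpr := .sub (.reg 4) (.mul (.div (.reg 4) (.reg 0)) (.reg 0))

/-- The occupation numbers in a row of a list. -/
def rowOf (ℓ : ℕ) (A : ℕ → ℕ) (k : ℕ) (a : Bits ℓ) : ℕ :=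
  A (k * 2 ^ ℓ + (finFunctionFinEquiv a : ℕ))

theorem eval_rowExpr_leftExpr (M : Store) (a : Bits ℓ) :
    (rowExpr leftExpr a).eval M = rowOf ℓ (M.arr 0) (M.reg 4 / M.reg 0) a := rfl

theorem eval_rowExpr_rightExpr (M : Store) (a : Bits ℓ) :
    (rowExpr rightExpr a).eval M = rowOf ℓ (M.arr 0) (M.reg 4 % M.reg 0) a := by
  rw [Nat.mod_eq_sub_mul_div, mul_comm (M.reg 0)]
  rfl

/-- The entry of the Gram matrix. -/
noncomputable def gramExpr (ℓ : ℕ) : RealExpr :=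
  .mul (.ofNat (.prod fun a : Bits ℓ => .eq (rowExpr leftExpr a) (rowExpr rightExpr a)))
    (.div (.arr 3 (.add (.reg 1) (.const 2)))
      (.prod fun a : Bits ℓ => .arr 3 (rowExpr leftExpr a)))

/-- An integer constant. -/
def intExpr (k : ℤ) : RealExpr :=
  -- The language has only natural constants; at least one of the two parts is zero.
  .sub (.ofNat (.const k.toNat)) (.ofNat (.const (-k).toNat))

theorem eval_intExpr (M : Store) (k : ℤ) : (intExpr k).eval M = k := by
  simp only [intExpr, RealExpr.eval, NatExpr.eval]
  have := Int.toNat_sub_toNat_neg k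
  exact_mod_cast this

/-- The entry of the reduced matrix. -/
noncomputable def reducedExpr (S : Fin n → PauliString ℓ) : RealExpr :=
  .sum fun p : Bits ℓ × Bits ℓ => .sum fun q : Bits ℓ × Bits ℓ =>
    .mul (.sum fun i : Fin n => .mul (intExpr ((S i).pairEntry p q)) (.arr 0 (.const i)))
      (.mul
        (.ofNat (.prod fun a : Bits ℓ => .mul
          -- A strict comparison with the successor expresses ≤; the product of such tests is the
          -- indicator of the conjunction.
          (.lt (.const (pairCount p a)) (.add (rowExpr leftExpr a) (.const 1)))
          (.eq (.add (rowExpr leftExpr a) (.const (pairCount q a)))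
            (.add (rowExpr rightExpr a) (.const (pairCount p a))))))
        (.div (.arr 3 (.reg 1))
          (.prod fun a : Bits ℓ => .arr 3 (.sub (rowExpr leftExpr a) (.const (pairCount p a))))))

theorem prod_ite_one_zero {κ R : Type*} [Fintype κ] [CommMonoidWithZero R] (P : κ → Prop)
    [DecidablePred P] : ∏ a, (if P a then (1 : R) else 0) = if ∀ a, P a then 1 else 0 := by
  rw [Finset.prod_ite_zero]
  simp

/-- The bound on the row keeps every lookup within the table of factorials, which is only known up
to m + 2. -/
theorem eval_gramExpr {w : Fin n → ℝ} {m V : ℕ} {M : Store} (h : Prepared w m V M)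
    (hrow : ∀ a, rowOf ℓ (M.arr 0) (M.reg 4 / M.reg 0) a ≤ m + 2) :
    (gramExpr ℓ).eval M = gramEntry m (rowOf ℓ (M.arr 0) (M.reg 4 / M.reg 0))
      (rowOf ℓ (M.arr 0) (M.reg 4 % M.reg 0)) := by
  simp only [gramExpr, RealExpr.eval, NatExpr.eval_prod, RealExpr.eval_prod, gramEntry]
  congr 1
  · simp only [NatExpr.eval, eval_rowExpr_leftExpr, eval_rowExpr_rightExpr]
    rw [prod_ite_one_zero]
    split_ifs <;> simp
  · simp only [NatExpr.eval, h.level, h.factorials _ le_rfl, eval_rowExpr_leftExpr]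
    congr 1
    exact Finset.prod_congr rfl fun a _ => h.factorials _ (hrow a)

theorem eval_reducedExpr (S : Fin n → PauliString ℓ) {w : Fin n → ℝ} {m V : ℕ} {M : Store}
    (h : Prepared w m V M) (hrow : ∀ a, rowOf ℓ (M.arr 0) (M.reg 4 / M.reg 0) a ≤ m + 2) :
    (reducedExpr S).eval M = reducedEntry S w m (rowOf ℓ (M.arr 0) (M.reg 4 / M.reg 0))
      (rowOf ℓ (M.arr 0) (M.reg 4 % M.reg 0)) := by
  simp only [reducedExpr, RealExpr.eval_sum, reducedEntry]
  refine Finset.sum_congr rfl fun p _ => Finset.sum_congr rfl fun q _ => ?_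
  simp only [RealExpr.eval, RealExpr.eval_sum, NatExpr.eval_prod, RealExpr.eval_prod,
    eval_intExpr]
  congr 1
  · exact Finset.sum_congr rfl fun i _ => by rw [← h.weights i]; rfl
  congr 1
  · simp only [NatExpr.eval, eval_rowExpr_leftExpr, eval_rowExpr_rightExpr, Nat.lt_succ_iff,
      ite_mul, one_mul, zero_mul, ← ite_and]
    rw [prod_ite_one_zero]
    split_ifs <;> simp
  · simp only [NatExpr.eval, h.level, h.factorials m (by omega), eval_rowExpr_leftExpr]
    congr 1
    exact Finset.prod_congr rfl fun a _ => h.factorials _ ((Nat.sub_le _ _).trans (hrow a))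

/-- One step of the computation of the matrices. -/
noncomputable def matrixBody (S : Fin n → PauliString ℓ) : Program :=
  .seq (.rstore 1 (.reg 4) (reducedExpr S))
    (.seq (.rstore 2 (.reg 4) (gramExpr ℓ)) (.assign 4 (.add (.reg 4) (.const 1))))

/-- The invariant of the computation of the matrices. -/
structure MatrixInv (S : Fin n → PauliString ℓ) (w : Fin n → ℝ) (m V D : ℕ) (A : ℕ → ℕ) (j : ℕ)
    (M : Store) : Prop where
  prepared : Prepared w m V M
  number : M.reg 0 = D
  list : M.arr 0 = A
  index : M.reg 4 = j
  reduced : ∀ i < j, M.rarr 1 i = reducedEntry S w m (rowOf ℓ A (i / D)) (rowOf ℓ A (i % D))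
  gram : ∀ i < j, M.rarr 2 i = gramEntry m (rowOf ℓ A (i / D)) (rowOf ℓ A (i % D))

theorem MatrixInv.step {S : Fin n → PauliString ℓ} {w : Fin n → ℝ} {m V D : ℕ} {A : ℕ → ℕ} {j : ℕ}
    {M : Store} (h : MatrixInv S w m V D A j M) (hA : ∀ k < D, ∀ a, rowOf ℓ A k a ≤ m + 2)
    (hj : j < D * D) (hV : D * D ≤ V) :
    MatrixInv S w m V D A (j + 1) ((matrixBody S).result M) := by
  have hrow : ∀ a, rowOf ℓ (M.arr 0) (M.reg 4 / M.reg 0) a ≤ m + 2 := by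
    rw [h.list, h.index, h.number]
    exact hA _ (Nat.div_lt_of_lt_mul hj)
  have hred := eval_reducedExpr S h.prepared hrow
  -- The Gram entry is evaluated after the reduced entry has been written; that write touches
  -- nothing the evaluation reads.
  set M' := M.setRarr 1 ((NatExpr.reg 4).eval M) ((reducedExpr S).eval M) with hM'
  have hp' : Prepared w m V M' := by
    refine ⟨h.prepared.bounded.setRarr _ _ _, h.prepared.level, fun i => ?_, fun k hk => ?_⟩
    · simpa [hM', Store.setRarr] using h.prepared.weights i
    · simpa [hM', Store.setRarr] using h.prepared.factorials k hk
  have hgram := eval_gramExpr (ℓ := ℓ) hp' hrow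
  change _ = gramEntry m (rowOf ℓ (M.arr 0) (M.reg 4 / M.reg 0))
    (rowOf ℓ (M.arr 0) (M.reg 4 % M.reg 0)) at hgram
  rw [h.list, h.index, h.number] at hred hgram
  simp only [matrixBody, Program.result, ← hM']
  refine ⟨⟨?_, ?_, fun i => ?_, fun k hk => ?_⟩, ?_, ?_, ?_, fun i hi => ?_, fun i hi => ?_⟩
  · refine (hp'.bounded.setRarr _ _ _).setReg ?_
    simp only [NatExpr.eval, hM', Store.setRarr, h.index]
    omega
  · simpa [Store.setReg, Store.setRarr] using hp'.level
  · simpa [Store.setReg, Store.setRarr] using hp'.weights i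
  · simpa [Store.setReg, Store.setRarr] using hp'.factorials k hk
  · simpa [Store.setReg, Store.setRarr, hM'] using h.number
  · simpa [Store.setReg, Store.setRarr, hM'] using h.list
  · simp [Store.setReg, Store.setRarr, hM', NatExpr.eval, h.index]
  · rcases (Nat.lt_succ_iff.1 hi).eq_or_lt with rfl | hlt
    · simp [Store.setReg, Store.setRarr, hM', NatExpr.eval, h.index, hred]
    · simpa [Store.setReg, Store.setRarr, hM', NatExpr.eval, h.index, hlt.ne] using
        h.reduced i hlt
  · rcases (Nat.lt_succ_iff.1 hi).eq_or_lt with rfl | hlt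
    · simp only [Store.setReg, Store.setRarr, Function.update_self]
      rw [hgram]
      simp [hM', Store.setRarr, NatExpr.eval, h.index]
    · simpa [Store.setReg, Store.setRarr, hM', NatExpr.eval, h.index, hlt.ne] using
        h.gram i hlt

end MatrixProgram

/-! ### The complete program and its cost -/

section MainProgram

variable {n ℓ : ℕ}

/-- Copy the level to register `1`, and begin the table of factorials. -/
def initProgram : Program :=
  .seq (.assign 1 (.reg 0)) (.rstore 3 (.const 0) (.ofNat (.const 1)))

/-- The program that computes the data of the reduced program. -/
noncomputable def mainProgram (S : Fin n → PauliString ℓ) : Program :=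
  .seq initProgram
    (.seq (.loop (.lt (.reg 2) (.add (.reg 1) (.const 2))) factorialBody)
      (.seq (.assign 0 (.const 0))
        (.seq (.loop (.lt (.reg 3) (basePowExpr (2 ^ ℓ))) (enumBody (2 ^ ℓ)))
          (.loop (.lt (.reg 4) (.mul (.reg 0) (.reg 0))) (matrixBody S)))))

theorem initialStore_bounded {w : Fin n → ℝ} {m V : ℕ} (h : m ≤ V) :
    (initialStore w m).BoundedBy V := by
  refine ⟨fun i => ?_, fun _ _ => Nat.zero_le _⟩
  simp only [initialStore]
  split_ifs <;> omega

theorem factorialInv_init {w : Fin n → ℝ} {m V : ℕ} (h : m ≤ V) :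
    FactorialInv w m V 0 (initProgram.result (initialStore w m)) := by
  simp only [initProgram, Program.result]
  refine ⟨?_, ?_, fun i => ?_, fun k hk => ?_, ?_, ?_⟩
  · exact ((initialStore_bounded h).setReg ((initialStore_bounded h).1 0)).setRarr _ _ _
  · simp [Store.setReg, Store.setRarr, NatExpr.eval, initialStore]
  · simp [Store.setReg, Store.setRarr, initialStore]
  · obtain rfl : k = 0 := by omega
    simp [Store.setReg, Store.setRarr, NatExpr.eval, RealExpr.eval]
  · simp [Store.setReg, Store.setRarr, initialStore]
  · simp [Store.setReg, Store.setRarr, initialStore]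

theorem enumInv_init {w : Fin n → ℝ} {d m V : ℕ} {M : Store}
    (h : FactorialInv w m V (m + 2) M) :
    EnumInv w d m V 0 ((Program.assign 0 (.const 0)).result M) := by
  simp only [Program.result]
  refine ⟨⟨h.bounded.setReg (Nat.zero_le _), ?_, h.weights, h.factorials⟩, ?_, ?_, ?_,
    fun q hq => absurd hq (Nat.not_lt_zero q)⟩
  · simpa [Store.setReg] using h.level
  · simpa [Store.setReg] using h.rest.1
  · simpa [Store.setReg] using h.rest.2
  · simp [Store.setReg, NatExpr.eval]

/-- The `k`-th row of the list produced by the enumeration is the `k`-th multiset. -/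
theorem EnumInv.exists_equiv {w : Fin n → ℝ} {m V : ℕ} {M : Store}
    (h : EnumInv w (2 ^ ℓ) m V ((m + 3) ^ 2 ^ ℓ) M) :
    ∃ e : Fin (M.reg 0) ≃ Sym (Bits ℓ) (m + 2), ∀ (k : Fin (M.reg 0)) (a : Bits ℓ),
      rowOf ℓ (M.arr 0) k a = Multiset.count a (e k : Multiset (Bits ℓ)) := by
  obtain ⟨e, he⟩ := exists_equiv_sym ℓ m
  refine ⟨(finCongr h.number).trans e, fun k a => ?_⟩
  obtain ⟨q, hq, hcode, hcount, hrow⟩ := he (finCongr h.number k)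
  rw [Equiv.trans_apply, ← hrow a, rowOf,
    ← h.rows q hq hcode (finFunctionFinEquiv a) (finFunctionFinEquiv a).2, hcount]
  rfl

theorem holdsReducedProgram_of_inv {S : Fin n → PauliString ℓ} {w : Fin n → ℝ} {m V D : ℕ}
    {A : ℕ → ℕ} {M : Store} (h : MatrixInv S w m V D A (D * D) M)
    (e : Fin D ≃ Sym (Bits ℓ) (m + 2))
    (he : ∀ (k : Fin D) (a : Bits ℓ), rowOf ℓ A k a = Multiset.count a (e k : Multiset (Bits ℓ))) :
    HoldsReducedProgram S w m M := by
  obtain ⟨hp, rfl, rfl, hidx, hred, hgram⟩ := h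
  have hrow : ∀ k : Fin (M.reg 0), rowOf ℓ (M.arr 0) k =
      fun a => Multiset.count a (e k : Multiset (Bits ℓ)) := fun k => funext (he k)
  refine ⟨e, he, fun k l => ?_⟩
  have hD : 0 < M.reg 0 := k.pos
  have hlt : (k : ℕ) * M.reg 0 + l < M.reg 0 * M.reg 0 := by
    calc _ < (k : ℕ) * M.reg 0 + M.reg 0 := Nat.add_lt_add_left l.2 _
      _ = (k + 1) * M.reg 0 := by ring
      _ ≤ _ := Nat.mul_le_mul_right _ k.2
  have hdiv : ((k : ℕ) * M.reg 0 + l) / M.reg 0 = k := by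
    rw [mul_comm, Nat.mul_add_div hD, Nat.div_eq_of_lt l.2, add_zero]
  have hmod : ((k : ℕ) * M.reg 0 + l) % M.reg 0 = l := by
    rw [mul_comm, Nat.mul_add_mod, Nat.mod_eq_of_lt l.2]
  rw [hred _ hlt, hgram _ hlt, hdiv, hmod, hrow, hrow, reducedMatrix_apply, gramMatrix_apply]
  exact ⟨rfl, rfl⟩

theorem exists_program (S : Fin n → PauliString ℓ) :
    ∃ (P : Program) (p : Polynomial ℕ), ∀ (w : Fin n → ℝ) (m : ℕ),
      ∃ (c : ℕ) (M : Store), Exec P (initialStore w m) c M ∧ c ≤ p.eval m ∧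
        HoldsReducedProgram S w m M := by
  obtain ⟨p₀, _, h₀⟩ := Program.LoopFree.exists_runs (P := initProgram) ⟨trivial, trivial⟩
  obtain ⟨p₁, h₁⟩ := exists_loop_runs (.lt (.reg 2) (.add (.reg 1) (.const 2)))
    (P := factorialBody) ⟨trivial, trivial⟩
  obtain ⟨p₂, _, h₂⟩ := Program.LoopFree.exists_runs (P := .assign 0 (.const 0)) trivial
  obtain ⟨p₃, h₃⟩ := exists_loop_runs (.lt (.reg 3) (basePowExpr (2 ^ ℓ)))
    (loopFree_enumBody (2 ^ ℓ))
  obtain ⟨p₄, h₄⟩ := exists_loop_runs (.lt (.reg 4) (.mul (.reg 0) (.reg 0)))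
    (P := matrixBody S) ⟨trivial, trivial, trivial⟩
  -- With d = 2^ℓ, the bound V = (m+3)^{2d} is the square of the number B of candidate codes. It
  -- dominates the level, the code counter and the D² ≤ B² matrix positions, so it serves in every
  -- phase, and for fixed ℓ it is a polynomial in m.
  refine ⟨mainProgram S, (p₀ + (p₁ + (p₂ + (p₃ + p₄)))).comp
    ((Polynomial.X + 3) ^ (2 ^ ℓ + 2 ^ ℓ)), fun w m => ?_⟩
  simp only [Polynomial.eval_comp, Polynomial.eval_pow, Polynomial.eval_add, Polynomial.eval_X,
    Polynomial.eval_ofNat]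
  set B := (m + 3) ^ 2 ^ ℓ with hB
  have hmB : m + 3 ≤ B := Nat.le_self_pow (by positivity) _
  have hBV : B ≤ (m + 3) ^ (2 ^ ℓ + 2 ^ ℓ) := Nat.pow_le_pow_right (by omega) (Nat.le_add_left _ _)
  have hBBV : B * B = (m + 3) ^ (2 ^ ℓ + 2 ^ ℓ) := (pow_add _ _ _).symm
  set V := (m + 3) ^ (2 ^ ℓ + 2 ^ ℓ)
  have hinit : (initialStore w m).BoundedBy V := initialStore_bounded (by omega)
  suffices Runs (mainProgram S) (initialStore w m)
      (p₀.eval V + (p₁.eval V + (p₂.eval V + (p₃.eval V + p₄.eval V))))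
      (HoldsReducedProgram S w m) from this
  refine (h₀ V _ hinit).seq fun M₁ hM₁ => ?_
  have hF : FactorialInv w m V 0 M₁ := hM₁.1 ▸ factorialInv_init (by omega)
  refine (h₁ V (m + 2) (FactorialInv w m V) (by omega) (fun j _ M h => h.bounded)
    (fun j hj M h => ⟨?_, h.step (by omega)⟩) (fun M h => ?_) M₁ hF).seq fun M₂ hM₂ => ?_
  · simp [NatExpr.eval, h.counter, h.level, hj]
  · simp [NatExpr.eval, h.counter, h.level]
  refine (h₂ V M₂ hM₂.bounded).seq fun M₃ hM₃ => ?_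
  have hE : EnumInv w (2 ^ ℓ) m V 0 M₃ := hM₃.1 ▸ enumInv_init hM₂
  refine (h₃ V B (EnumInv w (2 ^ ℓ) m V) hBV (fun j _ M h => h.prepared.bounded)
    (fun j hj M h => ⟨?_, h.step (by omega) (by omega)⟩) (fun M h => ?_) M₃ hE).seq
      fun M₄ hM₄ => ?_
  · simp [NatExpr.eval, eval_basePowExpr, h.counter, h.prepared.level, ← hB, hj]
  · simp [NatExpr.eval, eval_basePowExpr, h.counter, h.prepared.level, ← hB]
  obtain ⟨e, he⟩ := hM₄.exists_equiv
  have hDB : M₄.reg 0 ≤ B := hM₄.number ▸ Nat.count_le _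
  have hDV : M₄.reg 0 * M₄.reg 0 ≤ V := hBBV ▸ Nat.mul_le_mul hDB hDB
  have hA : ∀ k < M₄.reg 0, ∀ a, rowOf ℓ (M₄.arr 0) k a ≤ m + 2 := by
    intro k hk a
    have := he ⟨k, hk⟩ a
    rw [this]
    exact (Multiset.count_le_card _ _).trans (Sym.card_coe (s := e ⟨k, hk⟩)).le
  refine (h₄ V (M₄.reg 0 * M₄.reg 0) (MatrixInv S w m V (M₄.reg 0) (M₄.arr 0)) hDV
    (fun j _ M h => h.prepared.bounded) (fun j hj M h => ⟨?_, h.step hA hj hDV⟩) (fun M h => ?_)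
    M₄ ⟨hM₄.prepared, rfl, rfl, hM₄.index, fun i hi => absurd hi (Nat.not_lt_zero i),
      fun i hi => absurd hi (Nat.not_lt_zero i)⟩).mono le_rfl
    fun M h => holdsReducedProgram_of_inv h e he
  · simp [NatExpr.eval, h.number, h.index, hj]
  · simp [NatExpr.eval, h.number, h.index]

end MainProgram

end BoseHierarchy

theorem theorem3 :
    (∃ C : ℝ, 0 < C ∧
      ∀ (n ℓ : ℕ) (G : SimpleGraph (Fin n)) (S : Fin n → PauliString ℓ),
        IsFrustrationGraph G S →
      ∀ w : Fin n → ℝ, (∀ i, 0 ≤ w i) →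
        (∀ m : ℕ, IsGreatest (extensionValues S w m) (extensionBound S w m)) ∧
        (∀ m : ℕ, 0 ≤ extensionBound S w m - betaNumber S w) ∧
        Antitone (extensionBound S w) ∧
        Filter.Tendsto (extensionBound S w) Filter.atTop (nhds (betaNumber S w)) ∧
        ∀ K : ℝ, ∑ i, w i ≤ K * n → ∀ m : ℕ, 1 ≤ m →
          extensionBound S w m - betaNumber S w ≤ C * K * ((n : ℝ) * 2 ^ ℓ / m)) ∧
    (∀ (n ℓ : ℕ) (G : SimpleGraph (Fin n)) (S : Fin n → PauliString ℓ),
        IsFrustrationGraph G S →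
      (∀ m : ℕ,
        LinearIndependent ℂ
          (dickeVector : Sym (Bits ℓ) (m + 2) → (Fin (m + 2) → Bits ℓ) → ℂ) ∧
        Submodule.span ℂ (Set.range
          (dickeVector : Sym (Bits ℓ) (m + 2) → (Fin (m + 2) → Bits ℓ) → ℂ)) =
            symSubspace (Bits ℓ) (m + 2)) ∧
      (∀ w : Fin n → ℝ, (∀ i, 0 ≤ w i) → ∀ m : ℕ,
        IsGreatest (reducedValues S w m) (extensionBound S w m)) ∧
      ∃ (P : Program) (p : Polynomial ℕ),
        ∀ w : Fin n → ℝ, (∀ i, 0 ≤ w i) → ∀ m : ℕ,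
          ∃ (c : ℕ) (M : Store), Exec P (initialStore w m) c M ∧ c ≤ p.eval m ∧
            HoldsReducedProgram S w m M) := by
  refine ⟨⟨6, by norm_num, fun n ℓ G S _ w hw => ⟨isGreatest_extensionBound S w,
    fun m => sub_nonneg.2 (betaNumber_le_extensionBound S hw m), antitone_extensionBound S w,
    tendsto_extensionBound S hw, fun K hK m hm => ?_⟩⟩, fun n ℓ G S _ => ⟨fun m =>
    ⟨linearIndependent_dickeVector _, span_dickeVector _⟩,
    fun w _ m => isGreatest_reducedValues S w m, ?_⟩⟩
  · calc extensionBound S w m - betaNumber S w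
        ≤ 6 * (∑ i, w i) * (2 ^ ℓ / m) := extensionBound_sub_betaNumber_le S hw hm
      _ ≤ 6 * (K * n) * (2 ^ ℓ / m) := by gcongr
      _ = 6 * K * ((n : ℝ) * 2 ^ ℓ / m) := by ring
  · obtain ⟨P, p, h⟩ := exists_program S
    exact ⟨P, p, fun w _ m => h w m⟩
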